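/- For $n\ge 1$ let $e_1,\dots,e_n$ be the standard orthonormal basis of $\mathbb{R}^n$. Let $C_n$ be the group generated by the orthogonal reflections of $\mathbb{R}^n$ with roots $e_i$ $(1\le i\le n)$ and $e_i\pm e_j$ $(i\ne j)$; this is the group of signed coordinate permutations, i.e. the symmetry group of the $n$-cube, of order $2^n n!$. Let $D_n$ be the group generated by the reflections with roots $e_i\pm e_j$ $(i\neq j)$; this is the group of signed coordinate permutations with an even number of sign changes, of order $2^{n-1}n!$. Let $A_n$ be the group generated by the reflections of $\mathbb{R}^{n+1}$ with roots $e_i-e_j$ $(i\ne j)$; it is isomorphic to the symmetric group $\mathfrak{S}_{n+1}$. For a finite group $G$, let $\mathbb{P}_{\varphi\in\mathrm{End}(G)}[\varphi\text{ is an automorphism}]=|\mathrm{Aut}(G)|/|\mathrm{End}(G)|$ be the probability that an endomorphism $\varphi$ drawn uniformly at random from the set $\mathrm{End}(G)$ of all group homomorphisms $G\to G$ is an automorphism. Then $$\lim_{n\to\infty}\mathbb{P}_{\varphi\in\mathrm{End}(C_{2n})}[\varphi\text{ is an automorphism}]=\tfrac12,\qquad \lim_{n\to\infty}\mathbb{P}_{\varphi\in\mathrm{End}(D_{n})}[\varphi\text{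 is an automorphism}]=\tfrac12,$$ $$\lim_{n\to\infty}\mathbb{P}_{\varphi\in\mathrm{End}(C_{2n+1})}[\varphi\text{ is an automorphism}]=\tfrac14,\qquad \lim_{n\to\infty}\mathbb{P}_{\varphi\in\mathrm{End}(A_{n})}[\varphi\text{ is an automorphism}]=1.$$ -/

import Mathlib

open Filter Topology

namespace ReflectionGroups

/-- The reflection group generated by the orthogonal reflections in the hyperplanes `v⟂`,
for `v` in the set of roots `Φ`. -/
noncomputable def reflectionGroup {E : Type*} [NormedAddCommGroup E] [InnerProductSpace ℝ E]
    (Φ : Set E) : Subgroup (E ≃ₗᵢ[ℝ] E) :=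
  Subgroup.closure {r | ∃ v ∈ Φ, r = (Submodule.span ℝ {v})ᗮ.reflection}

/-- The standard orthonormal basis vector `e i` of Euclidean space. -/
noncomputable def e {n : ℕ} (i : Fin n) : EuclideanSpace ℝ (Fin n) :=
  EuclideanSpace.single i (1 : ℝ)

/-- The roots of type `A n`: all `e i - e j` with `i ≠ j` in `ℝ ^ (n + 1)`. -/
def rootsA (n : ℕ) : Set (EuclideanSpace ℝ (Fin (n + 1))) :=
  {v | ∃ i j, i ≠ j ∧ v = e i - e j}

/-- The roots of type `D n`: all `e i - e j` and `e i + e j` with `i ≠ j` in `ℝ ^ n`. -/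
def rootsD (n : ℕ) : Set (EuclideanSpace ℝ (Fin n)) :=
  {v | ∃ i j, i ≠ j ∧ (v = e i - e j ∨ v = e i + e j)}

/-- The roots of type `C n`: those of type `D n` together with all `e i`.
(Only the lines spanned by the roots matter here, so `e i` may stand for `2 • e i`.) -/
def rootsC (n : ℕ) : Set (EuclideanSpace ℝ (Fin n)) :=
  rootsD n ∪ {v | ∃ i, v = e i}

/-- The reflection group of type `A n`, acting on `ℝ ^ (n + 1)` by coordinate permutations. -/
noncomputable abbrev A (n : ℕ) : Subgroup
    (EuclideanSpace ℝ (Fin (n + 1)) ≃ₗᵢ[ℝ] EuclideanSpace ℝ (Fin (n + 1))) :=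
  reflectionGroup (rootsA n)

/-- The reflection group of type `C n`, acting on `ℝ ^ n` by signed coordinate permutations. -/
noncomputable abbrev C (n : ℕ) : Subgroup
    (EuclideanSpace ℝ (Fin n) ≃ₗᵢ[ℝ] EuclideanSpace ℝ (Fin n)) :=
  reflectionGroup (rootsC n)

/-- The reflection group of type `D n`, acting on `ℝ ^ n` by signed coordinate permutations
with an even number of sign changes. -/
noncomputable abbrev D (n : ℕ) : Subgroup
    (EuclideanSpace ℝ (Fin n) ≃ₗᵢ[ℝ] EuclideanSpace ℝ (Fin n)) :=
  reflectionGroup (rootsD n)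

/-- The probability that an endomorphism of `G`, drawn uniformly at random from the (finite) set
of all endomorphisms of `G`, is an automorphism. -/
noncomputable def probAut (G : Type*) [Group G] : ℝ :=
  (Nat.card {φ : G →* G // Function.Bijective φ} : ℝ) / (Nat.card (G →* G) : ℝ)

end ReflectionGroups

/-! Each of these groups is a semidirect product `N ⋊ S_m` with `N` commutative of order at most `2
^ m`: all sign vectors for type C, the even ones for type D, the trivial group for type A (where `m
= n + 1`). Let `m ≥ 7`, and let `φ` be an endomorphism. The composite `S_m → N ⋊ S_m → S_m` of `φ`
with the projection is either injective or trivial on the alternating group.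

In the injective case it is an automorphism of `S_m`, hence inner (`exists_eq_conj`). After a
conjugation `φ` lies over the identity of `S_m`; it then maps `N` into `N`, because the image of `N`
in `S_m` is a commutative normal subgroup. So `φ` amounts to a permutation, an equivariant
endomorphism `θ` of `N` and a section of the projection, and it is bijective exactly when `θ` is.
The permutations and the sections contribute the same factor to the count of automorphisms and to
the count of these endomorphisms, so the sections need not be counted.

In the other case `φ` itself kills the alternating group, which is perfect while `N` is commutative.
Such a `φ` is determined by its restriction to a group of order four, and there are only about `m ^
(3 * m / 4)` actions of such a group on `m` points, up to a factor exponential in `m`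
(`card_hom_perm_pow_mul_le`). This is negligible against `m!`.

The limit is therefore the proportion of bijections among the equivariant endomorphisms of `N`. With
`c` the map that repeats the product of the signs, they are `1`, `id`, `c`, `id * c` for all sign
vectors, where `id * c` is bijective only for even `m`. For even sign vectors only `1` and `id`
remain, and for trivial `N` only one. The proportions are `2/4` or `1/4`, `1/2`, and `1`. -/

namespace Equiv.Perm

/-! ### Automorphisms of symmetric groups -/

/-- The order of the centralizer of a product of `k` disjoint transpositions in a symmetric group
on `m + 2 * k ≥ 7` letters is, for `k ≥ 2`, smaller than that of a transposition. -/
lemma factorial_mul_two_pow_lt {k m : ℕ} (hk : 2 ≤ k) (h : 7 ≤ m + 2 * k) :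
    m.factorial * 2 ^ k * k.factorial < 2 * (m + 2 * k - 2).factorial := by
  have step : ∀ j, 2 ≤ j →
      m.factorial * 2 ^ j * j.factorial < 2 * (m + 2 * j - 2).factorial →
      m.factorial * 2 ^ (j + 1) * (j + 1).factorial
        < 2 * (m + 2 * (j + 1) - 2).factorial := by
    intro j hj ih
    have e : m + 2 * (j + 1) - 2 = (m + 2 * j - 2) + 1 + 1 := by omega
    rw [e, Nat.factorial_succ, Nat.factorial_succ, Nat.factorial_succ, pow_succ]
    have h1 : 2 * (j + 1) ≤ (m + 2 * j - 2 + 1 + 1) * (m + 2 * j - 2 + 1) := by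
      have a : 3 ≤ m + 2 * j - 2 + 1 := by omega
      have b : 2 * j ≤ m + 2 * j - 2 + 1 + 1 := by omega
      nlinarith
    calc m.factorial * (2 ^ j * 2) * ((j + 1) * j.factorial)
        = (m.factorial * 2 ^ j * j.factorial) * (2 * (j + 1)) := by ring
      _ < (2 * (m + 2 * j - 2).factorial) * (2 * (j + 1)) :=
          Nat.mul_lt_mul_of_pos_right ih (by omega)
      _ ≤ (2 * (m + 2 * j - 2).factorial) *
            ((m + 2 * j - 2 + 1 + 1) * (m + 2 * j - 2 + 1)) := Nat.mul_le_mul_left _ h1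
      _ = _ := by ring
  have main : ∀ j₀, 2 ≤ j₀ → j₀ ≤ k →
      m.factorial * 2 ^ j₀ * j₀.factorial < 2 * (m + 2 * j₀ - 2).factorial →
      m.factorial * 2 ^ k * k.factorial < 2 * (m + 2 * k - 2).factorial := by
    intro j₀ h0 h1 h2
    exact Nat.le_induction h2 (fun j hj ih => step j (h0.trans hj) ih) k h1
  -- The induction on `k` starts at `2` if `m ≥ 3`, and otherwise at the least `k` that `h` allows.
  -- The excluded case `m = 0`, `k = 3` is an equality, `48 = 48`; it belongs to the outer
  -- automorphism of the symmetric group on six letters.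
  rcases lt_or_ge 2 m with hm | hm
  · refine main 2 le_rfl hk ?_
    have e : m + 2 * 2 - 2 = m + 1 + 1 := by omega
    have e' : (m + 1 + 1).factorial = (m + 1 + 1) * (m + 1) * m.factorial := by
      rw [Nat.factorial_succ, Nat.factorial_succ, mul_assoc]
    rw [e, e', Nat.factorial_two]
    have h20 : 20 ≤ (m + 1 + 1) * (m + 1) := by nlinarith
    have := Nat.mul_le_mul_right m.factorial h20
    have := m.factorial_pos
    omega
  · interval_cases m
    · exact main 4 (by omega) (by omega) (by decide)
    · exact main 3 (by omega) (by omega) (by decide)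
    · exact main 3 (by omega) (by omega) (by decide)

lemma card_centralizer_swap {n : ℕ} {t : Perm (Fin n)} (ht : t.IsSwap) :
    Nat.card (Subgroup.centralizer {t}) = (n - 2).factorial * 2 := by
  rw [nat_card_centralizer, isSwap_iff_cycleType.mp ht]
  simp

/-- The image of a transposition has order two, so it is a product of `l` disjoint transpositions.
Automorphisms preserve the orders of centralizers, and these exclude `l ≥ 2`. -/
lemma map_isSwap {n : ℕ} (hn : 7 ≤ n) (α : Perm (Fin n) ≃* Perm (Fin n)) {t : Perm (Fin n)}
    (ht : t.IsSwap) : (α t).IsSwap := by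
  have hord : orderOf (α t) = 2 := by rw [MulEquiv.orderOf_eq, ht.orderOf]
  obtain ⟨k, hk⟩ := cycleType_prime_order (σ := α t) (by rw [hord]; exact Nat.prime_two)
  rw [hord] at hk
  have hl : 1 ≤ k + 1 := by omega
  generalize k + 1 = l at hk hl
  have hc : Nat.card (Subgroup.centralizer {α t}) = Nat.card (Subgroup.centralizer {t}) := by
    refine (Nat.card_congr (Equiv.subtypeEquiv α.toEquiv fun a => ?_)).symm
    simp only [Subgroup.mem_centralizer_singleton_iff, MulEquiv.toEquiv_eq_coe,
      EquivLike.coe_coe, ← map_mul, EmbeddingLike.apply_eq_iff_eq]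
  have hsum : l * 2 ≤ n := by
    have := (α t).sum_cycleType_le
    rw [hk] at this
    simpa using this
  rw [card_centralizer_swap ht, nat_card_centralizer, hk] at hc
  rcases hl.eq_or_lt with rfl | hl
  · exact isSwap_iff_cycleType.mpr (by simpa using hk)
  · exfalso
    have := factorial_mul_two_pow_lt (k := l) (m := n - l * 2) hl (by omega)
    have e : n - l * 2 + 2 * l - 2 = n - 2 := by omega
    rw [e] at this
    have hl0 : l ≠ 0 := by omega
    simp [Multiset.toFinset_replicate, hl0] at hc
    omega

lemma exists_common_of_not_commute {α : Type*} [DecidableEq α] {a b x y : α}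
    (h : ¬ Commute (swap a b) (swap x y)) : x = a ∨ x = b ∨ y = a ∨ y = b := by
  by_contra! hne
  refine h (Disjoint.commute fun z => ?_)
  by_cases hz : z = a ∨ z = b
  · right
    rcases hz with rfl | rfl <;> exact swap_apply_of_ne_of_ne (by tauto) (by tauto)
  · left
    exact swap_apply_of_ne_of_ne (by tauto) (by tauto)

lemma exists_common_eq_swap {α : Type*} [DecidableEq α] {s t : Perm α} (hs : s.IsSwap)
    (ht : t.IsSwap) (h : ¬ Commute s t) : ∃ c a b, a ≠ b ∧ s = swap c a ∧ t = swap c b := by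
  obtain ⟨a, b, hab, rfl⟩ := hs
  obtain ⟨x, y, hxy, rfl⟩ := ht
  have key : ∀ c u v : α, ¬ Commute (swap c u) (swap c v) → u ≠ v := by
    rintro c u _ h rfl
    exact h (Commute.refl _)
  rcases exists_common_of_not_commute h with rfl | rfl | rfl | rfl
  · exact ⟨x, b, y, key _ _ _ h, rfl, rfl⟩
  · rw [swap_comm a x] at h ⊢
    exact ⟨x, a, y, key _ _ _ h, rfl, rfl⟩
  · rw [swap_comm x y] at h ⊢
    exact ⟨y, b, x, key _ _ _ h, rfl, rfl⟩
  · rw [swap_comm x y, swap_comm a y] at h ⊢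
    exact ⟨y, a, x, key _ _ _ h, rfl, rfl⟩

lemma not_commute_swap_swap {α : Type*} [DecidableEq α] {o i j : α} (hi : i ≠ o) (hj : j ≠ o)
    (hij : i ≠ j) : ¬ Commute (swap o i) (swap o j) := by
  intro h
  have := congrArg (fun σ : Perm α => σ o) h.eq
  simp only [mul_apply, swap_apply_left, swap_apply_of_ne_of_ne hj hij.symm,
    swap_apply_of_ne_of_ne hi hij] at this
  exact hij this.symm

lemma swap_mul_swap_mul_swap_left {α : Type*} [DecidableEq α] {c a b : α} (hcb : c ≠ b)
    (hab : a ≠ b) : swap c a * swap c b * swap c a = swap a b := by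
  have := swap_apply_apply (swap c a) c b
  rwa [swap_apply_left, swap_apply_of_ne_of_ne hcb.symm hab.symm, swap_inv, eq_comm] at this

/-- An automorphism of a symmetric group that maps transpositions to transpositions is inner. -/
lemma exists_eq_conj_of_map_isSwap {n : ℕ} (hn : 3 ≤ n) (α : Perm (Fin n) ≃* Perm (Fin n))
    (hα : ∀ t : Perm (Fin n), t.IsSwap → (α t).IsSwap) :
    ∃ σ : Perm (Fin n), ∀ τ, α τ = σ * τ * σ⁻¹ := by
  let o : Fin n := ⟨0, by omega⟩
  let p : Fin n := ⟨1, by omega⟩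
  let q : Fin n := ⟨2, by omega⟩
  have hpo : p ≠ o := by simp [p, o]
  have hqo : q ≠ o := by simp [q, o]
  have hpq : p ≠ q := by simp [p, q]
  have hsw : ∀ {j}, j ≠ o → (α (swap o j)).IsSwap := fun hj => hα _ ⟨o, _, hj.symm, rfl⟩
  have hcomm : ∀ {i j}, i ≠ o → j ≠ o → i ≠ j → ¬ Commute (α (swap o i)) (α (swap o j)) := by
    intro i j hi hj hij h
    exact not_commute_swap_swap hi hj hij (h.of_map α.injective)
  obtain ⟨c, a, b, hab, hp, hq⟩ :=
    exists_common_eq_swap (hsw hpo) (hsw hqo) (hcomm hpo hqo hpq)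
  have hca : c ≠ a := by
    rintro rfl
    have := hsw hpo
    rw [hp, swap_self] at this
    simpa using this.sign_eq
  have hcb : c ≠ b := by
    rintro rfl
    have := hsw hqo
    rw [hq, swap_self] at this
    simpa using this.sign_eq
  -- The images of the transpositions through `o` all pass through the common point `c`, which will
  -- be the image of `o` under the conjugating permutation.
  have hf : ∀ j, α (swap o j) = swap c (α (swap o j) c) := by
    intro j
    by_cases hjo : j = o
    · rw [hjo, swap_self, ← one_def, map_one, one_apply, swap_self, one_def]
    by_cases hjp : j = p
    · subst hjp; simp [hp]
    by_cases hjq : j = q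
    · subst hjq; simp [hq]
    obtain ⟨x, y, hxy, hj⟩ := hsw hjo
    have h1 := hcomm hpo hjo (Ne.symm hjp)
    have h2 := hcomm hqo hjo (Ne.symm hjq)
    -- A transposition that meets both `{c, a}` and `{c, b}` but avoids `c` is `swap a b`, which is
    -- already the image of `swap p q`.
    have hne : α (swap o j) ≠ swap a b := by
      intro hj'
      have : swap o j = swap p q := α.injective <| by
        rw [hj', ← swap_mul_swap_mul_swap_left hcb hab,
          ← swap_mul_swap_mul_swap_left hqo.symm hpq, map_mul, map_mul, hp, hq]
      have := congrArg (fun σ : Perm (Fin n) => σ o) this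
      simp only [swap_apply_left, swap_apply_of_ne_of_ne hpo.symm hqo.symm] at this
      exact hjo this
    rw [hj] at h1 h2 hne ⊢
    rw [hp] at h1
    rw [hq] at h2
    have h1 := exists_common_of_not_commute h1
    have h2 := exists_common_of_not_commute h2
    have : x = c ∨ y = c := by
      by_contra! hcc
      rcases h1 with h | h | h | h
      · exact hcc.1 h
      · rcases h2 with h' | h' | h' | h'
        · exact hcc.1 h'
        · exact hab (h.symm.trans h')
        · exact hcc.2 h'
        · exact hne (by rw [h, h'])
      · exact hcc.2 h
      · rcases h2 with h' | h' | h' | h'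
        · exact hcc.1 h'
        · exact hne (by rw [h, h', swap_comm])
        · exact hcc.2 h'
        · exact hab (h.symm.trans h')
    rcases this with rfl | rfl
    · simp
    · rw [swap_apply_right, swap_comm]
  have hinj : Function.Injective fun j => α (swap o j) c := by
    intro i j hij
    have : swap o i = swap o j := α.injective (by rw [hf i, hf j]; exact congrArg _ hij)
    simpa using congrArg (fun σ : Perm (Fin n) => σ o) this
  let σ : Perm (Fin n) := Equiv.ofBijective _ (Finite.injective_iff_bijective.mp hinj)
  have hσ : ∀ j, σ j = α (swap o j) c := fun _ => rfl
  have hσo : σ o = c := by rw [hσ, swap_self, ← one_def, map_one, one_apply]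
  have hstar : ∀ j, α (swap o j) = σ * swap o j * σ⁻¹ := by
    intro j
    rw [hf, ← hσ, ← hσo, ← swap_apply_apply]
  refine ⟨σ, fun τ => ?_⟩
  have : α.toMonoidHom = (MulAut.conj σ).toMonoidHom := by
    refine MonoidHom.eq_of_eqOn_dense closure_isSwap ?_
    rintro _ ⟨i, j, hij, rfl⟩
    have : ∃ l : List (Fin n), swap i j = (l.map (swap o)).prod := by
      by_cases hi : i = o
      · exact ⟨[j], by simp [hi]⟩
      by_cases hj : j = o
      · exact ⟨[i], by simp [hj, swap_comm]⟩
      · exact ⟨[i, j, i], by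
          simp [← mul_assoc, swap_mul_swap_mul_swap_left (Ne.symm hj) hij]⟩
    obtain ⟨l, hl⟩ := this
    rw [hl, map_list_prod, map_list_prod]
    simp [Function.comp_def, hstar]
  exact DFunLike.congr_fun this τ

/-- Every automorphism of a symmetric group on at least seven letters is inner. -/
theorem exists_eq_conj {n : ℕ} (hn : 7 ≤ n) (α : Perm (Fin n) ≃* Perm (Fin n)) :
    ∃ σ : Perm (Fin n), ∀ τ, α τ = σ * τ * σ⁻¹ :=
  exists_eq_conj_of_map_isSwap (by omega) α fun _ => map_isSwap hn α

end Equiv.Perm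

/-! ### Counting actions of a finite group on `n` points -/

/-- The number of self-maps of `Fin n` with at least `m` fixed points. -/
lemma card_filter_fixed_le (n m : ℕ) :
    (Finset.univ.filter fun f : Fin n → Fin n =>
      m ≤ (Finset.univ.filter fun i => f i = i).card).card ≤ n ^ (n - m) * 2 ^ n := by
  -- The maps are sorted by their set `R` of fixed points: there are at most `2 ^ n` sets, and a map
  -- is free only outside `R`.
  refine (Finset.card_le_mul_card_image
    (f := fun f : Fin n → Fin n => Finset.univ.filter fun i => f i = i) _ (n ^ (n - m)) ?_).trans ?_
  · intro R hR
    have hm : m ≤ R.card := by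
      obtain ⟨f, hf, rfl⟩ := Finset.mem_image.mp hR
      exact (Finset.mem_filter.mp hf).2
    have hRn : R.card ≤ n := by simpa using Finset.card_le_univ R
    calc _ ≤ (Finset.univ : Finset ({i // i ∉ R} → Fin n)).card := by
          refine Finset.card_le_card_of_injOn (fun f i => f i) (fun _ _ => Finset.mem_univ _) ?_
          intro f hf g hg hfg
          simp only [Finset.coe_filter, Finset.mem_filter, Finset.mem_univ, true_and,
            Set.mem_ofPred_eq] at hf hg
          funext i
          by_cases hi : i ∈ R
          · have h1 := hi
            have h2 := hi
            rw [← hf.2, Finset.mem_filter] at h1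
            rw [← hg.2, Finset.mem_filter] at h2
            rw [h1.2, h2.2]
          · exact congrFun hfg ⟨i, hi⟩
      _ = n ^ (n - R.card) := by
          rw [Finset.card_univ, Fintype.card_fun, Fintype.card_fin, Fintype.card_subtype_compl,
            Fintype.card_fin, Fintype.card_coe]
      _ ≤ n ^ (n - m) := by
          rcases Nat.eq_zero_or_pos n with rfl | hn
          · simp
          · exact Nat.pow_le_pow_right hn (by omega)
  · refine Nat.mul_le_mul_left _ ((Finset.card_le_univ _).trans ?_)
    simp

section Action

variable {A : Type*} [Group A] {n : ℕ}

/-- The orbit equivalence relation of a permutation representation. -/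
def orbitSetoid (ρ : A →* Equiv.Perm (Fin n)) : Setoid (Fin n) where
  r i j := ∃ g, ρ g i = j
  iseqv := by
    refine ⟨fun i => ⟨1, by simp⟩, ?_, ?_⟩
    · rintro i _ ⟨g, rfl⟩
      exact ⟨g⁻¹, by simp⟩
    · rintro i _ _ ⟨g, rfl⟩ ⟨h, rfl⟩
      exact ⟨h * g, by simp⟩

/-- A chosen representative of the orbit of a point. -/
noncomputable def orbitRep (ρ : A →* Equiv.Perm (Fin n)) (i : Fin n) : Fin n :=
  (Quotient.mk (orbitSetoid ρ) i).out

lemma orbitRep_spec (ρ : A →* Equiv.Perm (Fin n)) (i : Fin n) : ∃ g, ρ g (orbitRep ρ i) = i :=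
  Quotient.exact (s := orbitSetoid ρ) (Quotient.out_eq _)

lemma orbitRep_apply (ρ : A →* Equiv.Perm (Fin n)) (g : A) (i : Fin n) :
    orbitRep ρ (ρ g i) = orbitRep ρ i :=
  congrArg Quotient.out (Quotient.sound (s := orbitSetoid ρ) ⟨g⁻¹, by simp⟩)

lemma orbitRep_orbitRep (ρ : A →* Equiv.Perm (Fin n)) (i : Fin n) :
    orbitRep ρ (orbitRep ρ i) = orbitRep ρ i := by
  obtain ⟨g, hg⟩ := orbitRep_spec ρ i
  conv_rhs => rw [← hg, orbitRep_apply]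

/-- The set of group elements that carry the orbit representative of a point to that point. -/
def transporter (ρ : A →* Equiv.Perm (Fin n)) (i : Fin n) : Set A :=
  {g | ρ g (orbitRep ρ i) = i}

/-- If `x` carries the representative to `i`, then `g * x` carries it to `g i`; so these data
determine the action. -/
lemma eq_of_orbitRep_eq_of_transporter_eq {ρ₁ ρ₂ : A →* Equiv.Perm (Fin n)}
    (h₁ : orbitRep ρ₁ = orbitRep ρ₂) (h₂ : transporter ρ₁ = transporter ρ₂) : ρ₁ = ρ₂ := by
  ext1 g
  ext1 i
  obtain ⟨x, hx⟩ := orbitRep_spec ρ₁ i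
  have hx₂ : ρ₂ x (orbitRep ρ₂ i) = i := by
    have : x ∈ transporter ρ₁ i := hx
    rwa [h₂] at this
  have hgx : g * x ∈ transporter ρ₁ (ρ₁ g i) := by
    simp only [transporter, Set.mem_ofPred_eq, orbitRep_apply, map_mul, Equiv.Perm.mul_apply, hx]
  have hrep : orbitRep ρ₂ (ρ₁ g i) = orbitRep ρ₂ i := by rw [← h₁, orbitRep_apply]
  rw [h₂] at hgx
  simp only [transporter, Set.mem_ofPred_eq, hrep, map_mul, Equiv.Perm.mul_apply, hx₂] at hgx
  exact hgx.symm

/-- The fixed points of `orbitRep` are the chosen representatives, one for each orbit, and an orbit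
has at most `|A|` points. -/
lemma le_card_mul_card_fixed [Finite A] (ρ : A →* Equiv.Perm (Fin n)) :
    n ≤ Nat.card A * (Finset.univ.filter fun i => orbitRep ρ i = i).card := by
  classical
  have := Fintype.ofFinite A
  have := Finset.card_le_mul_card_image_of_maps_to (s := (Finset.univ : Finset (Fin n)))
    (t := Finset.univ.filter fun i => orbitRep ρ i = i) (f := orbitRep ρ)
    (fun i _ => by simp [orbitRep_orbitRep]) (Nat.card A) (by
      intro r _
      refine (Finset.card_le_card (t := Finset.univ.image fun g => ρ g r) ?_).trans
        (Finset.card_image_le.trans (by simp))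
      intro i hi
      obtain ⟨g, hg⟩ := orbitRep_spec ρ i
      rw [(Finset.mem_filter.mp hi).2] at hg
      exact Finset.mem_image.mpr ⟨g, Finset.mem_univ _, hg⟩)
  simpa using this

/-- The number of actions of a finite group of order `a` on `n` points is at most
`2 ^ ((a + 1) * n) * n ^ ((1 - 1 / a) * n)`. -/
theorem card_hom_perm_pow_mul_le [Finite A] :
    Nat.card (A →* Equiv.Perm (Fin n)) ^ Nat.card A * n ^ n
      ≤ 2 ^ ((Nat.card A + 1) * n * Nat.card A) * n ^ (Nat.card A * n) := by
  classical
  have := Fintype.ofFinite A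
  set a := Nat.card A with ha
  have ha0 : 0 < a := Nat.card_pos
  -- Here `m` is `n / a` rounded up, a lower bound for the number of orbits.
  obtain ⟨m, hm, hmn⟩ : ∃ m, (∀ k, n ≤ a * k → m ≤ k) ∧ n ≤ a * m := by
    have hex : ∃ k, n ≤ a * k := ⟨n, Nat.le_mul_of_pos_left n ha0⟩
    exact ⟨Nat.find hex, fun k hk => Nat.find_min' hex hk, Nat.find_spec hex⟩
  have hle : m ≤ n := hm n (Nat.le_mul_of_pos_left n ha0)
  let S := Finset.univ.filter fun f : Fin n → Fin n =>
      m ≤ (Finset.univ.filter fun i => f i = i).card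
  have hcard : Nat.card (A →* Equiv.Perm (Fin n)) ≤ n ^ (n - m) * 2 ^ ((a + 1) * n) := by
    -- The first component costs at most `n ^ (n - m) * 2 ^ n`, the second `2 ^ (a * n)`.
    let code : (A →* Equiv.Perm (Fin n)) → S × (Fin n → Set A) := fun ρ =>
      (⟨orbitRep ρ, by
        simp only [S, Finset.mem_filter, Finset.mem_univ, true_and]
        exact hm _ (le_card_mul_card_fixed ρ)⟩, transporter ρ)
    have hinj : Function.Injective code := by
      intro ρ₁ ρ₂ h
      simp only [code, Prod.mk.injEq, Subtype.mk.injEq] at h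
      exact eq_of_orbitRep_eq_of_transporter_eq h.1 h.2
    refine (Nat.card_le_card_of_injective code hinj).trans ?_
    rw [Nat.card_prod, Nat.card_eq_fintype_card, Fintype.card_coe, Nat.card_eq_fintype_card,
      Fintype.card_fun, Fintype.card_set, Fintype.card_fin, ← Nat.card_eq_fintype_card, ← ha]
    refine (Nat.mul_le_mul_right _ (card_filter_fixed_le n m)).trans (le_of_eq ?_)
    rw [← pow_mul, mul_assoc, ← pow_add]
    ring_nf
  calc Nat.card (A →* Equiv.Perm (Fin n)) ^ a * n ^ n
      ≤ (n ^ (n - m) * 2 ^ ((a + 1) * n)) ^ a * n ^ n :=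
        Nat.mul_le_mul_right _ (Nat.pow_le_pow_left hcard a)
    _ = 2 ^ ((a + 1) * n * a) * n ^ ((n - m) * a + n) := by
        rw [mul_pow, ← pow_mul, ← pow_mul, pow_add]; ring
    _ ≤ 2 ^ ((a + 1) * n * a) * n ^ (a * n) := by
        refine Nat.mul_le_mul_left _ ?_
        rcases Nat.eq_zero_or_pos n with rfl | hn
        · simp
        · refine Nat.pow_le_pow_right hn ?_
          obtain ⟨d, rfl⟩ := Nat.exists_eq_add_of_le hle
          rw [Nat.add_sub_cancel_left]
          nlinarith

end Action

/-! ### Endomorphisms over the quotient of a semidirect product -/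

namespace SemidirectProduct

open Equiv.Perm

/-- The endomorphisms of the kernel of a semidirect product that commute with the action. -/
abbrev EquivariantEnd {N P : Type*} [Group N] [Group P] (act : P →* MulAut N) : Type _ :=
  {θ : N →* N // ∀ σ v, θ (act σ v) = act σ (θ v)}

/-- The sections of the projection of a semidirect product. -/
abbrev Section {N P : Type*} [Group N] [Group P] (act : P →* MulAut N) : Type _ :=
  {s : P →* N ⋊[act] P // (rightHom : N ⋊[act] P →* P).comp s = MonoidHom.id P}

variable {N P : Type*} [CommGroup N] [Group P] {act : P →* MulAut N}

lemma right_section (s : Section act) (τ : P) : (s.1 τ).right = τ :=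
  DFunLike.congr_fun s.2 τ

/-- Since the kernel is commutative, conjugation on it depends on the right component only. -/
lemma mul_inl_mul_inv (g : N ⋊[act] P) (v : N) : g * inl v * g⁻¹ = inl (act g.right v) := by
  ext
  · simp [mul_comm]
  · simp

/-- The endomorphism over `P` given by an equivariant endomorphism and a section. -/
def endOfSection (θ : EquivariantEnd act) (s : Section act) : N ⋊[act] P →* N ⋊[act] P :=
  lift (inl.comp θ.1) s.1 fun τ => by
    ext1 v
    simp only [MonoidHom.comp_apply, MulEquiv.coe_toMonoidHom, MulAut.conj_apply,
      mul_inl_mul_inv, right_section, θ.2]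

lemma endOfSection_inl (θ : EquivariantEnd act) (s : Section act) (v : N) :
    endOfSection θ s (inl v) = inl (θ.1 v) := by simp [endOfSection]

lemma endOfSection_inr (θ : EquivariantEnd act) (s : Section act) (τ : P) :
    endOfSection θ s (inr τ) = s.1 τ := by simp [endOfSection]

lemma right_endOfSection (θ : EquivariantEnd act) (s : Section act) (g : N ⋊[act] P) :
    (endOfSection θ s g).right = g.right := by
  simp [endOfSection, lift, right_section]

/-- The endomorphism preserves right components, so its kernel lies in `N`, where it acts as `θ`. -/
lemma endOfSection_injective_iff (θ : EquivariantEnd act) (s : Section act) :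
    Function.Injective (endOfSection θ s) ↔ Function.Injective θ.1 := by
  constructor
  · intro h v w hvw
    exact inl_injective (h (by rw [endOfSection_inl, endOfSection_inl, hvw]))
  · intro h
    rw [injective_iff_map_eq_one]
    intro g hg
    have hr : g.right = 1 := by rw [← right_endOfSection θ s, hg, one_right]
    have hgl : g = inl g.left := by ext <;> simp [hr]
    rw [hgl, endOfSection_inl, ← map_one inl, inl_inj] at hg
    rw [hgl, (injective_iff_map_eq_one _).mp h _ hg, map_one]

/-- The endomorphism `endOfSection`, followed by the conjugation by an element of `P`. -/
def endOfTriple (x : P × EquivariantEnd act × Section act) : N ⋊[act] P →* N ⋊[act] P :=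
  (MulAut.conj (inr x.1)).toMonoidHom.comp (endOfSection x.2.1 x.2.2)

lemma endOfTriple_bijective_iff [Finite N] [Finite P] (x : P × EquivariantEnd act × Section act) :
    Function.Bijective (endOfTriple x) ↔ Function.Bijective x.2.1.1 := by
  have : Finite (N ⋊[act] P) := Finite.of_equiv _ equivProd.symm
  rw [← Finite.injective_iff_bijective, ← Finite.injective_iff_bijective,
    ← endOfSection_injective_iff x.2.1 x.2.2]
  exact (MulAut.conj (inr x.1 : N ⋊[act] P)).injective.of_comp_iff (endOfSection x.2.1 x.2.2)

lemma right_endOfTriple_inr (x : P × EquivariantEnd act × Section act) (τ : P) :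
    (endOfTriple x (inr τ)).right = x.1 * τ * x.1⁻¹ := by
  simp [endOfTriple, right_endOfSection]

/-- On right components the endomorphism is conjugation by the permutation component, which recovers
that component modulo the centre. Once the conjugation is cancelled, the restrictions to the two
factors give `θ` and `s`. -/
lemma endOfTriple_injective (hP : Subgroup.center P = ⊥) :
    Function.Injective (endOfTriple : P × EquivariantEnd act × Section act → _) := by
  rintro ⟨σ, θ, s⟩ ⟨σ', θ', s'⟩ h
  have hσ : σ = σ' := by
    have : σ'⁻¹ * σ ∈ Subgroup.center P := by
      rw [Subgroup.mem_center_iff]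
      intro τ
      have := congrArg right (DFunLike.congr_fun h (inr τ))
      rw [right_endOfTriple_inr, right_endOfTriple_inr] at this
      simp only at this
      rw [mul_inv_eq_iff_eq_mul] at this
      rw [mul_assoc, this]
      group
    rw [hP, Subgroup.mem_bot, inv_mul_eq_one] at this
    exact this.symm
  subst hσ
  have h' : endOfSection θ s = endOfSection θ' s' := by
    ext1 g
    exact (MulAut.conj (inr σ : N ⋊[act] P)).injective (DFunLike.congr_fun h g)
  have hθ : θ = θ' := Subtype.ext <| MonoidHom.ext fun v => inl_injective (by
    rw [← endOfSection_inl θ s, h', endOfSection_inl])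
  have hs : s = s' := Subtype.ext <| MonoidHom.ext fun τ => by
    rw [← endOfSection_inr θ s, h', endOfSection_inr]
  rw [hθ, hs]

/-- An endomorphism that is compatible with the projection comes from an equivariant endomorphism
and a section. -/
lemma exists_eq_endOfSection (φ : N ⋊[act] P →* N ⋊[act] P)
    (hr : ∀ τ, (φ (inr τ)).right = τ) (hl : ∀ v, (φ (inl v)).right = 1) :
    ∃ θ s, φ = endOfSection (act := act) θ s := by
  have key : ∀ v, φ (inl v) = inl (φ (inl v)).left := fun v => by ext <;> simp [hl]
  refine ⟨⟨⟨⟨fun v => (φ (inl v)).left, by simp⟩, fun v w => by simp [hl]⟩, fun σ v => ?_⟩,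
    ⟨φ.comp inr, MonoidHom.ext hr⟩, ?_⟩
  · refine inl_injective (φ := act) ?_
    change inl (φ (inl (act σ v))).left = inl (act σ (φ (inl v)).left)
    rw [← key, inl_aut, map_mul, map_mul, key v, map_inv, map_inv, mul_inl_mul_inv, hr]
    rfl
  · refine hom_ext ?_ ?_
    · ext1 v
      simp only [MonoidHom.comp_apply, endOfSection_inl]
      exact key v
    · ext1 τ
      simp only [MonoidHom.comp_apply, endOfSection_inr]

end SemidirectProduct

lemma finite_monoidHom (M N : Type*) [MulOneClass M] [MulOneClass N] [Finite M] [Finite N] :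
    Finite (M →* N) := DFunLike.finite _

/-! ### Homomorphisms out of symmetric groups -/

namespace Equiv.Perm

variable {m : ℕ}

/-- The alternating group on at least five letters is its own commutator subgroup. -/
lemma le_ker_of_map_commute {H : Type*} [Group H] (hm : 5 ≤ m)
    (f : Perm (Fin m) →* H)
    (hf : ∀ σ ∈ alternatingGroup (Fin m), ∀ τ ∈ alternatingGroup (Fin m), Commute (f σ) (f τ)) :
    alternatingGroup (Fin m) ≤ f.ker := by
  rw [← commutator_alternatingGroup_eq_self (α := Fin m) (by simpa using hm),
    Subgroup.commutator_le]
  intro σ hσ τ hτ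
  rw [MonoidHom.mem_ker, map_commutatorElement, commutatorElement_eq_one_iff_commute]
  exact hf σ hσ τ hτ

lemma alternatingGroup_ne_bot (hm : 5 ≤ m) : alternatingGroup (Fin m) ≠ ⊥ := by
  have := alternatingGroup.nontrivial_of_three_le_card (α := Fin m) (by simp; omega)
  exact (Subgroup.nontrivial_iff_ne_bot _).mp this

/-- A commutative normal subgroup of a symmetric group on at least five letters is trivial. -/
lemma eq_bot_of_normal_of_commute (hm : 5 ≤ m) (K : Subgroup (Perm (Fin m))) [K.Normal]
    (hK : ∀ σ ∈ K, ∀ τ ∈ K, Commute σ τ) : K = ⊥ := by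
  by_contra hne
  have hle := alternatingGroup_le_of_normal (α := Fin m) (by simpa using hm)
    ((Subgroup.nontrivial_iff_ne_bot K).mpr hne)
  have := le_ker_of_map_commute hm (MonoidHom.id _) fun σ hσ τ hτ => hK σ (hle hσ) τ (hle hτ)
  refine alternatingGroup_ne_bot hm (le_bot_iff.mp (this.trans ?_))
  intro x hx
  simpa using hx

lemma center_eq_bot (hm : 5 ≤ m) : Subgroup.center (Perm (Fin m)) = ⊥ :=
  eq_bot_of_normal_of_commute hm _ fun _ hσ τ _ => Subgroup.mem_center_iff.mp hσ τ |>.symm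

lemma injective_or_alternatingGroup_le_ker {H : Type*} [Group H] (hm : 5 ≤ m)
    (f : Perm (Fin m) →* H) : Function.Injective f ∨ alternatingGroup (Fin m) ≤ f.ker := by
  by_cases h : f.ker = ⊥
  · exact Or.inl ((MonoidHom.ker_eq_bot_iff f).mp h)
  · exact Or.inr (alternatingGroup_le_of_normal (by simpa using hm)
      ((Subgroup.nontrivial_iff_ne_bot _).mpr h))

end Equiv.Perm

/-! ### The two kinds of endomorphisms of `N ⋊ S_m`, and their numbers -/

namespace SemidirectProduct

open Equiv.Perm Equiv

variable {m : ℕ} {N : Type*} [CommGroup N] {act : Perm (Fin m) →* MulAut N}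

/-- An endomorphism that is injective modulo the kernel on the symmetric group comes from an
equivariant endomorphism, a section and a conjugation. -/
lemma exists_eq_endOfTriple (hm : 7 ≤ m) (φ : N ⋊[act] Perm (Fin m) →* N ⋊[act] Perm (Fin m))
    (hφ : Function.Injective fun τ => (φ (inr τ)).right) :
    ∃ x, endOfTriple (act := act) x = φ := by
  let α : Perm (Fin m) ≃* Perm (Fin m) :=
    MulEquiv.ofBijective ((rightHom.comp φ).comp inr) (Finite.injective_iff_bijective.mp hφ)
  obtain ⟨σ, hσ⟩ := exists_eq_conj hm α
  let φ' : N ⋊[act] Perm (Fin m) →* N ⋊[act] Perm (Fin m) :=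
    (MulAut.conj (inr σ⁻¹)).toMonoidHom.comp φ
  have hr : ∀ τ, (φ' (inr τ)).right = τ := by
    intro τ
    have : (φ (inr τ)).right = σ * τ * σ⁻¹ := hσ τ
    simp [φ', this, mul_assoc]
  let β : N →* Perm (Fin m) := (rightHom.comp φ').comp inl
  have hnormal : β.range.Normal := by
    refine ⟨?_⟩
    rintro _ ⟨v, rfl⟩ τ
    refine ⟨act τ v, ?_⟩
    simp only [β, MonoidHom.comp_apply, inl_aut, map_mul, rightHom_eq_right, hr]
  -- The image of `N` in `S_m` is normal since `φ'` induces the identity on `S_m`, and commutative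
  -- since `N` is.
  have hβ : β.range = ⊥ := by
    refine eq_bot_of_normal_of_commute (by omega) _ ?_
    rintro _ ⟨v, rfl⟩ _ ⟨w, rfl⟩
    exact (Commute.all v w).map β
  have hl : ∀ v, (φ' (inl v)).right = 1 := fun v => by
    have : β v ∈ β.range := ⟨v, rfl⟩
    rwa [hβ, Subgroup.mem_bot] at this
  obtain ⟨θ, s, h⟩ := exists_eq_endOfSection φ' hr hl
  refine ⟨(σ, θ, s), ?_⟩
  ext1 g
  change MulAut.conj (inr σ) (endOfSection θ s g) = φ g
  rw [← h]
  simp [φ', mul_assoc]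

/-- The endomorphisms that are trivial on the alternating group. -/
abbrev AlternatingTrivialEnd (act : Perm (Fin m) →* MulAut N) : Type _ :=
  {φ : N ⋊[act] Perm (Fin m) →* N ⋊[act] Perm (Fin m) //
    alternatingGroup (Fin m) ≤ (φ.comp inr).ker}

/-- If the projection of `φ` to `S_m` kills the alternating group, then `φ` maps that group into the
commutative group `N`, so perfectness shows that `φ` kills it too. -/
lemma injective_or_alternatingGroup_le_ker_comp (hm : 5 ≤ m)
    (φ : N ⋊[act] Perm (Fin m) →* N ⋊[act] Perm (Fin m)) :
    (Function.Injective fun τ => (φ (inr τ)).right) ∨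
      alternatingGroup (Fin m) ≤ (φ.comp inr).ker := by
  refine (injective_or_alternatingGroup_le_ker hm ((rightHom.comp φ).comp inr)).imp_right ?_
  intro h
  refine le_ker_of_map_commute hm _ fun σ hσ τ hτ => ?_
  have key : ∀ σ ∈ alternatingGroup (Fin m), φ (inr σ) = inl (φ (inr σ)).left := by
    intro σ hσ
    have : (φ (inr σ)).right = 1 := h hσ
    ext <;> simp [this]
  rw [MonoidHom.comp_apply, MonoidHom.comp_apply, key σ hσ, key τ hτ]
  exact (Commute.all _ _).map inl

lemma not_alternatingGroup_le_ker (hm : 5 ≤ m)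
    {φ : N ⋊[act] Perm (Fin m) →* N ⋊[act] Perm (Fin m)}
    (h : Function.Injective (φ.comp inr)) :
    ¬ alternatingGroup (Fin m) ≤ (φ.comp inr).ker := by
  rw [(MonoidHom.ker_eq_bot_iff _).mpr h, le_bot_iff]
  exact alternatingGroup_ne_bot hm

section Card

variable [Finite N]

instance : Finite (N ⋊[act] Perm (Fin m)) := Finite.of_equiv _ equivProd.symm

lemma card_bijective (hm : 7 ≤ m) :
    Nat.card {φ : N ⋊[act] Perm (Fin m) →* N ⋊[act] Perm (Fin m) // Function.Bijective φ} =
      m.factorial * Nat.card {θ : EquivariantEnd act // Function.Bijective θ.1} *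
        Nat.card (Section act) := by
  let f : Perm (Fin m) × {θ : EquivariantEnd act // Function.Bijective θ.1} × Section act →
      {φ : N ⋊[act] Perm (Fin m) →* N ⋊[act] Perm (Fin m) // Function.Bijective φ} :=
    fun x => ⟨endOfTriple (x.1, x.2.1.1, x.2.2), (endOfTriple_bijective_iff _).mpr x.2.1.2⟩
  have hf : Function.Bijective f := by
    constructor
    · rintro ⟨σ, ⟨θ, hθ⟩, s⟩ ⟨σ', ⟨θ', hθ'⟩, s'⟩ h
      have := endOfTriple_injective (center_eq_bot (by omega)) (congrArg Subtype.val h)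
      simp only [Prod.mk.injEq] at this
      obtain ⟨rfl, rfl, rfl⟩ := this
      rfl
    · rintro ⟨φ, hφ⟩
      obtain ⟨x, rfl⟩ := exists_eq_endOfTriple hm φ <|
        (injective_or_alternatingGroup_le_ker_comp (by omega) φ).resolve_right
          (not_alternatingGroup_le_ker (by omega) (hφ.1.comp inr_injective))
      exact ⟨(x.1, ⟨x.2.1, (endOfTriple_bijective_iff _).mp hφ⟩, x.2.2), rfl⟩
  rw [← Nat.card_congr (Equiv.ofBijective f hf), Nat.card_prod, Nat.card_prod,
    Nat.card_eq_fintype_card, Fintype.card_perm, Fintype.card_fin, mul_assoc]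

/-- The first summand shares the factors `m!` and `Nat.card (Section act)` with `card_bijective`, so
they cancel in the limit ratio; the second summand is the error term. -/
lemma card_end (hm : 7 ≤ m) :
    Nat.card (N ⋊[act] Perm (Fin m) →* N ⋊[act] Perm (Fin m)) =
      m.factorial * Nat.card (EquivariantEnd act) * Nat.card (Section act) +
        Nat.card (AlternatingTrivialEnd act) := by
  let f : (Perm (Fin m) × EquivariantEnd act × Section act) ⊕ AlternatingTrivialEnd act →
      (N ⋊[act] Perm (Fin m) →* N ⋊[act] Perm (Fin m)) := Sum.elim endOfTriple Subtype.val
  have hf : Function.Bijective f := by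
    constructor
    · refine (endOfTriple_injective (center_eq_bot (by omega))).sumElim
        Subtype.val_injective ?_
      rintro x ⟨φ, hφ⟩ rfl
      refine not_alternatingGroup_le_ker (by omega) ?_ hφ
      intro τ τ' h
      have := congrArg right h
      rw [MonoidHom.comp_apply, MonoidHom.comp_apply, right_endOfTriple_inr,
        right_endOfTriple_inr] at this
      simpa using this
    · intro φ
      rcases injective_or_alternatingGroup_le_ker_comp (by omega) φ with h | h
      · obtain ⟨x, hx⟩ := exists_eq_endOfTriple hm φ h
        exact ⟨Sum.inl x, hx⟩
      · exact ⟨Sum.inr ⟨φ, h⟩, rfl⟩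
  have := finite_monoidHom (N ⋊[act] Perm (Fin m)) (N ⋊[act] Perm (Fin m))
  have := finite_monoidHom N N
  have := finite_monoidHom (Perm (Fin m)) (N ⋊[act] Perm (Fin m))
  have : Finite (AlternatingTrivialEnd act) := Subtype.finite
  rw [← Nat.card_congr (Equiv.ofBijective f hf), Nat.card_sum, Nat.card_prod, Nat.card_prod,
    Nat.card_eq_fintype_card (α := Perm _), Fintype.card_perm, Fintype.card_fin, mul_assoc]

/-- The cocycle condition on the left components is ignored. This costs only `|N| ^ |A|`, which is
exponential in `m` when `|N| ≤ 2 ^ m` and `|A|` is fixed. -/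
lemma card_hom_le (A : Type*) [Group A] [Finite A] :
    Nat.card (A →* N ⋊[act] Perm (Fin m)) ≤
      Nat.card N ^ Nat.card A * Nat.card (A →* Perm (Fin m)) := by
  let f : (A →* N ⋊[act] Perm (Fin m)) → (A → N) × (A →* Perm (Fin m)) :=
    fun φ => (fun a => (φ a).left, rightHom.comp φ)
  have hf : Function.Injective f := by
    intro φ φ' h
    simp only [f, Prod.mk.injEq] at h
    ext1 a
    exact SemidirectProduct.ext (congrFun h.1 a) (DFunLike.congr_fun h.2 a)
  have := finite_monoidHom A (Perm (Fin m))
  refine (Nat.card_le_card_of_injective f hf).trans (le_of_eq ?_)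
  rw [Nat.card_prod, Nat.card_fun]

end Card

end SemidirectProduct

/-! ### The proportion of automorphisms up to a vanishing error -/

lemma Nat.pow_le_factorial_mul_exp (m : ℕ) :
    (m : ℝ) ^ m ≤ m.factorial * Real.exp 1 ^ m := by
  have := Real.pow_div_factorial_le_exp (x := m) (Nat.cast_nonneg m) m
  rw [div_le_iff₀ (by positivity)] at this
  rw [← Real.exp_nat_mul, mul_one, mul_comm]
  exact this

lemma tendsto_div_pow_self (K : ℝ) : Tendsto (fun m : ℕ => (K / m) ^ m) atTop (𝓝 0) := by
  refine squeeze_zero_norm' ?_ (tendsto_pow_atTop_nhds_zero_of_lt_one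
    (r := (1 / 2 : ℝ)) (by norm_num) (by norm_num))
  filter_upwards [eventually_ge_atTop (⌈2 * |K|⌉₊ + 1)] with m hm
  have hm' : 2 * |K| ≤ m := (Nat.le_ceil _).trans (by exact_mod_cast (Nat.le_succ _).trans hm)
  have hm0 : (0 : ℝ) < m := by
    have : 0 < m := by omega
    exact_mod_cast this
  rw [norm_pow, norm_div, Real.norm_eq_abs, Real.norm_eq_abs, Nat.abs_cast]
  refine pow_le_pow_left₀ (by positivity) ?_ m
  rw [div_le_iff₀ hm0]
  linarith

namespace ReflectionGroups

lemma probAut_congr {G H : Type*} [Group G] [Group H] (f : G ≃* H) : probAut G = probAut H := by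
  let F : (G →* G) ≃ (H →* H) := (f.monoidHomCongrLeftEquiv).trans f.monoidHomCongrRightEquiv
  have h : ∀ φ : G →* G, Function.Bijective φ ↔ Function.Bijective (F φ) := by
    intro φ
    change _ ↔ Function.Bijective (f ∘ φ ∘ f.symm)
    rw [f.bijective.of_comp_iff', Function.Bijective.of_comp_iff _ f.symm.bijective]
  unfold probAut
  rw [Nat.card_congr F, Nat.card_congr (F.subtypeEquiv
    (q := fun ψ : H →* H => Function.Bijective ψ) h)]

open SemidirectProduct Equiv Equiv.Perm

/-- The fourth root of `(2 ^ 36 * exp 1 ^ 4 / m) ^ m`, a bound for the proportion of the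
endomorphisms that are trivial on the alternating group. -/
noncomputable def errorBound (m : ℕ) : ℝ := √√((2 ^ 36 * Real.exp 1 ^ 4 / m) ^ m)

lemma tendsto_errorBound : Tendsto errorBound atTop (𝓝 0) := by
  have := ((tendsto_div_pow_self (2 ^ 36 * Real.exp 1 ^ 4)).sqrt).sqrt
  rwa [Real.sqrt_zero, Real.sqrt_zero] at this

/-- The fourth power clears the exponent `3 * m / 4` in the number of actions. It yields `(2 ^ m) ^
16` from `|N| ^ 4` and `2 ^ (20 * m)` from the actions, together `2 ^ (36 * m)`, while `m! ≥ (m / e)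
^ m` gives the factor `e ^ 4`. -/
lemma card_mul_card_hom_div_factorial_le {m : ℕ} (hm : 0 < m) {A N : Type*} [Group A]
    (hA : Nat.card A = 4) (hN : Nat.card N ≤ 2 ^ m) :
    ((Nat.card N ^ Nat.card A * Nat.card (A →* Perm (Fin m)) : ℕ) : ℝ) / m.factorial
      ≤ errorBound m := by
  have : Finite A := Nat.finite_of_card_ne_zero (by omega)
  have h := card_hom_perm_pow_mul_le (A := A) (n := m)
  rw [hA] at h ⊢
  set a := Nat.card N
  set b := Nat.card (A →* Perm (Fin m))
  refine Real.le_sqrt_of_sq_le (Real.le_sqrt_of_sq_le ?_)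
  have hm0 : (0 : ℝ) < m := by exact_mod_cast hm
  have hf : (0 : ℝ) < m.factorial := by positivity
  have hN' : (a : ℝ) ≤ 2 ^ m := by exact_mod_cast hN
  have h' : (b : ℝ) ^ 4 * m ^ m ≤ 2 ^ ((4 + 1) * m * 4) * m ^ (4 * m) := by exact_mod_cast h
  have hexp := Nat.pow_le_factorial_mul_exp m
  rw [← pow_mul, div_pow, div_pow, div_le_div_iff₀ (by positivity) (by positivity)]
  push_cast
  calc ((a : ℝ) ^ 4 * b) ^ (2 * 2) * m ^ m = (a : ℝ) ^ 16 * (b ^ 4 * m ^ m) := by ring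
    _ ≤ ((2 : ℝ) ^ m) ^ 16 * (2 ^ ((4 + 1) * m * 4) * m ^ (4 * m)) := by gcongr
    _ = (2 : ℝ) ^ (36 * m) * (m ^ m) ^ 4 := by ring
    _ ≤ (2 : ℝ) ^ (36 * m) * (m.factorial * Real.exp 1 ^ m) ^ 4 := by gcongr
    _ = (2 ^ 36 * Real.exp 1 ^ 4) ^ m * m.factorial ^ (2 * 2) := by rw [pow_mul]; ring

/-- The probability that an endomorphism of `N ⋊ S_m` is an automorphism is close to the
proportion of bijections among the equivariant endomorphisms of `N`, if the endomorphisms that are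
trivial on the alternating group are determined by their restrictions to a group of order four. -/
theorem abs_probAut_sub_le {m : ℕ} (hm : 7 ≤ m) {N : Type*} [CommGroup N]
    {act : Perm (Fin m) →* MulAut N} (hN : Nat.card N ≤ 2 ^ m) [Finite N]
    {A : Type*} [Group A] (hA : Nat.card A = 4) (j : A →* N ⋊[act] Perm (Fin m))
    (hj : Function.Injective fun φ : AlternatingTrivialEnd act => φ.1.comp j) :
    |probAut (N ⋊[act] Perm (Fin m)) -
        (Nat.card {θ : EquivariantEnd act // Function.Bijective θ.1} : ℝ) /
          Nat.card (EquivariantEnd act)| ≤ errorBound m := by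
  have : Finite A := Nat.finite_of_card_ne_zero (by omega)
  have := finite_monoidHom A (N ⋊[act] Perm (Fin m))
  have := finite_monoidHom N N
  have := finite_monoidHom (Perm (Fin m)) (N ⋊[act] Perm (Fin m))
  have hb : Nat.card (AlternatingTrivialEnd act) ≤ _ :=
    (Nat.card_le_card_of_injective _ hj).trans (card_hom_le A)
  have hb' : (Nat.card (AlternatingTrivialEnd act) : ℝ) / m.factorial ≤ errorBound m := by
    refine le_trans ?_ (card_mul_card_hom_div_factorial_le (by omega) hA hN)
    gcongr
  refine le_trans ?_ hb'
  unfold probAut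
  rw [card_bijective hm, card_end hm]
  have hu : Nat.card {θ : EquivariantEnd act // Function.Bijective θ.1} ≤
      Nat.card (EquivariantEnd act) := Nat.card_le_card_of_injective _ Subtype.val_injective
  have : Nonempty (EquivariantEnd act) := ⟨⟨MonoidHom.id N, fun _ _ => rfl⟩⟩
  have : Nonempty (Section act) := ⟨⟨inr, rightHom_comp_inr⟩⟩
  have he : 0 < Nat.card (EquivariantEnd act) := Nat.card_pos
  have hz : 0 < Nat.card (Section act) := Nat.card_pos
  generalize Nat.card {θ : EquivariantEnd act // Function.Bijective θ.1} = u at *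
  generalize Nat.card (EquivariantEnd act) = e at *
  generalize Nat.card (Section act) = z at *
  generalize Nat.card (AlternatingTrivialEnd act) = b at *
  have hf : (1 : ℝ) ≤ m.factorial := by exact_mod_cast m.factorial_pos
  have hu' : (u : ℝ) ≤ e := by exact_mod_cast hu
  have he' : (1 : ℝ) ≤ e := by exact_mod_cast he
  have hz' : (1 : ℝ) ≤ z := by exact_mod_cast hz
  push_cast
  generalize (m.factorial : ℝ) = f at *
  have hb0 : (0 : ℝ) ≤ b := Nat.cast_nonneg b
  have hu0 : (0 : ℝ) ≤ u := Nat.cast_nonneg u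
  have hden : 0 < f * e * z + b := by positivity
  -- The exact error is at most `b / f`, because `u ≤ e` and `f ≤ f * e * z + b`.
  have hkey : f * u * z / (f * e * z + b) - u / e = -(u * b / (e * (f * e * z + b))) := by
    field_simp
    ring
  rw [hkey, abs_neg, abs_of_nonneg (by positivity), div_le_div_iff₀ (by positivity) (by positivity)]
  have h1 : f ≤ f * e * z + b := by
    have : f * 1 * 1 ≤ f * e * z := by gcongr
    linarith
  calc (u : ℝ) * b * f ≤ e * b * (f * e * z + b) := by gcongr
    _ = b * (e * (f * e * z + b)) := by ring

end ReflectionGroups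

/-! ### Sign vectors and their generators -/

namespace ReflectionGroups

open SemidirectProduct Equiv Equiv.Perm

variable {m : ℕ}

/-- The permutation action of the symmetric group on the sign vectors. -/
abbrev signAct (m : ℕ) : Perm (Fin m) →* MulAut (Fin m → ℤˣ) := mulAutArrow

lemma signAct_apply (σ : Perm (Fin m)) (v : Fin m → ℤˣ) (i : Fin m) :
    signAct m σ v i = v (σ⁻¹ i) := rfl

lemma signAct_mulSingle (σ : Perm (Fin m)) (i : Fin m) (u : ℤˣ) :
    signAct m σ (Pi.mulSingle i u) = Pi.mulSingle (σ i) u := by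
  funext k
  rw [signAct_apply]
  by_cases h : k = σ i
  · subst h; simp
  · rw [Pi.mulSingle_eq_of_ne h, Pi.mulSingle_eq_of_ne]
    rintro rfl
    simp at h

/-- The product of the entries of a sign vector. -/
def signProd (m : ℕ) : (Fin m → ℤˣ) →* ℤˣ where
  toFun v := ∏ i, v i
  map_one' := by simp
  map_mul' v w := by simp [Finset.prod_mul_distrib]

lemma signProd_signAct (σ : Perm (Fin m)) (v : Fin m → ℤˣ) :
    signProd m (signAct m σ v) = signProd m v :=
  Equiv.prod_comp σ⁻¹ v

lemma signProd_mulSingle (i : Fin m) (u : ℤˣ) : signProd m (Pi.mulSingle i u) = u := by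
  simp [signProd]

/-- The sign vectors with an even number of negative entries. -/
abbrev evenSigns (m : ℕ) : Subgroup (Fin m → ℤˣ) := (signProd m).ker

/-- The permutation action of the symmetric group on the even sign vectors. -/
def evenSignAct (m : ℕ) : Perm (Fin m) →* MulAut (evenSigns m) where
  toFun σ :=
    { toFun := fun v => ⟨signAct m σ v, by
        rw [MonoidHom.mem_ker, signProd_signAct]; exact v.2⟩
      invFun := fun v => ⟨signAct m σ⁻¹ v, by
        rw [MonoidHom.mem_ker, signProd_signAct]; exact v.2⟩
      left_inv := fun v => by ext1; simp
      right_inv := fun v => by ext1; simp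
      map_mul' := fun v w => by ext1; simp }
  map_one' := by ext1 v; ext1; simp
  map_mul' σ τ := by ext1 v; ext1; simp

lemma coe_evenSignAct (σ : Perm (Fin m)) (v : evenSigns m) :
    (evenSignAct m σ v : Fin m → ℤˣ) = signAct m σ v := rfl

/-- The sign vector with negative entries at two places. -/
def pairSign (i j : Fin m) : evenSigns m :=
  ⟨Pi.mulSingle i (-1) * Pi.mulSingle j (-1), by
    rw [MonoidHom.mem_ker, map_mul, signProd_mulSingle, signProd_mulSingle]; simp⟩

lemma evenSignAct_pairSign (σ : Perm (Fin m)) (i j : Fin m) :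
    evenSignAct m σ (pairSign i j) = pairSign (σ i) (σ j) := by
  ext1
  rw [coe_evenSignAct, pairSign, map_mul, signAct_mulSingle, signAct_mulSingle]
  rfl

lemma pairSign_comm (i j : Fin m) : pairSign i j = pairSign j i :=
  Subtype.ext (mul_comm _ _)

lemma mulSingle_mul_self (i : Fin m) (u : ℤˣ) :
    (Pi.mulSingle i u : Fin m → ℤˣ) * Pi.mulSingle i u = 1 := by
  rw [← Pi.mulSingle_mul, Int.units_mul_self, Pi.mulSingle_one]

lemma pairSign_self (i : Fin m) : pairSign i i = 1 :=
  Subtype.ext (mulSingle_mul_self i _)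

lemma pairSign_mul_pairSign (i j k : Fin m) : pairSign i j * pairSign j k = pairSign i k := by
  ext1
  simp only [pairSign, Subgroup.coe_mul]
  rw [mul_assoc, ← mul_assoc (Pi.mulSingle j (-1)), mulSingle_mul_self, one_mul]

lemma closure_mulSingle :
    Subgroup.closure (Set.range fun i : Fin m => (Pi.mulSingle i (-1) : Fin m → ℤˣ)) = ⊤ := by
  rw [eq_top_iff]
  intro v _
  rw [← Finset.univ_prod_mulSingle v]
  refine Subgroup.prod_mem _ fun i _ => ?_
  rcases Int.units_eq_one_or (v i) with h | h
  · rw [h, Pi.mulSingle_one]; exact one_mem _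
  · rw [h]; exact Subgroup.subset_closure ⟨i, rfl⟩

/-- An even sign vector is the product of `pairSign i o` over its negative entries `i`: the number
of factors is even, so the extra signs at `o` cancel. -/
lemma closure_pairSign (o : Fin m) :
    Subgroup.closure {v | ∃ i, i ≠ o ∧ v = pairSign i o} = ⊤ := by
  rw [eq_top_iff]
  intro v _
  have hv : v = ∏ i, if v.1 i = -1 then pairSign i o else 1 := by
    ext1
    rw [Subgroup.val_finsetProd]
    calc v.1 = (∏ i, Pi.mulSingle i (v.1 i)) * (∏ i, Pi.mulSingle o (v.1 i)) := by
          rw [Finset.univ_prod_mulSingle]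
          have : ∏ i, Pi.mulSingle o (v.1 i) = (1 : Fin m → ℤˣ) := by
            have := map_prod (MonoidHom.mulSingle (fun _ : Fin m => ℤˣ) o) v.1 Finset.univ
            have h1 : ∏ i, v.1 i = 1 := v.2
            rw [h1, map_one] at this
            exact this.symm
          rw [this, mul_one]
      _ = _ := by
          rw [← Finset.prod_mul_distrib]
          refine Finset.prod_congr rfl fun i _ => ?_
          rcases Int.units_eq_one_or (v.1 i) with h | h
          · rw [h, if_neg (by decide)]; simp
          · rw [h, if_pos rfl]; rfl
  rw [hv]
  refine Subgroup.prod_mem _ fun i _ => ?_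
  split_ifs
  · by_cases hi : i = o
    · rw [hi, pairSign_self]; exact one_mem _
    · exact Subgroup.subset_closure ⟨i, hi, rfl⟩
  · exact one_mem _

end ReflectionGroups

/-! ### Equivariant endomorphisms of the groups of sign vectors -/

namespace ReflectionGroups

open SemidirectProduct Equiv Equiv.Perm

variable {m : ℕ}

section Signs

/-- The map that repeats the product of the entries of a sign vector. -/
def constSignProd (m : ℕ) : (Fin m → ℤˣ) →* (Fin m → ℤˣ) :=
  MonoidHom.pi fun _ => signProd m

lemma constSignProd_apply (v : Fin m → ℤˣ) (i : Fin m) :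
    constSignProd m v i = signProd m v := rfl

/-- The equivariant endomorphism `θ` with `θ (e o) o = x.1` and `θ (e o) k = x.2` for `k ≠ o`,
where `e o` is the sign vector with one negative entry, at `o`. -/
def signEnd (m : ℕ) (x : ℤˣ × ℤˣ) : EquivariantEnd (signAct m) :=
  -- Away from `o` only the factor `constSignProd` can contribute, so `x.2` decides on it; the
  -- identity factor is present when the entry at `o` differs.
  ⟨(if x.1 = x.2 then 1 else MonoidHom.id _) * (if x.2 = 1 then 1 else constSignProd m), by
    intro σ v
    have h : constSignProd m (signAct m σ v) = signAct m σ (constSignProd m v) := by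
      funext i
      rw [constSignProd_apply, signProd_signAct, signAct_apply, constSignProd_apply]
    split_ifs <;> simp [h]⟩

lemma signEnd_mulSingle_self (x : ℤˣ × ℤˣ) (o : Fin m) :
    (signEnd m x).1 (Pi.mulSingle o (-1)) o = x.1 := by
  obtain ⟨a, b⟩ := x
  rcases Int.units_eq_one_or a with rfl | rfl <;> rcases Int.units_eq_one_or b with rfl | rfl <;>
    simp [signEnd, constSignProd_apply, signProd_mulSingle]

lemma signEnd_mulSingle_of_ne (x : ℤˣ × ℤˣ) {o k : Fin m} (h : k ≠ o) :
    (signEnd m x).1 (Pi.mulSingle o (-1)) k = x.2 := by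
  obtain ⟨a, b⟩ := x
  rcases Int.units_eq_one_or a with rfl | rfl <;> rcases Int.units_eq_one_or b with rfl | rfl <;>
    simp [signEnd, constSignProd_apply, signProd_mulSingle, h]

/-- The image of the vector with one negative entry, at `o`, is fixed by the stabilizer of `o`, so
its entries away from `o` agree. The two remaining signs are arbitrary, and equivariance extends
them to all generators. -/
lemma signEnd_bijective {o p : Fin m} (hop : p ≠ o) :
    Function.Bijective (signEnd m) := by
  constructor
  · intro x y h
    ext1
    · rw [← signEnd_mulSingle_self x o, h, signEnd_mulSingle_self]
    · rw [← signEnd_mulSingle_of_ne x hop, h, signEnd_mulSingle_of_ne y hop]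
  · intro θ
    let x : ℤˣ × ℤˣ := (θ.1 (Pi.mulSingle o (-1)) o, θ.1 (Pi.mulSingle o (-1)) p)
    refine ⟨x, ?_⟩
    have ho : (signEnd m x).1 (Pi.mulSingle o (-1)) = θ.1 (Pi.mulSingle o (-1)) := by
      funext k
      by_cases hk : k = o
      · rw [hk, signEnd_mulSingle_self]
      · rw [signEnd_mulSingle_of_ne _ hk]
        have := congrFun (θ.2 (swap p k) (Pi.mulSingle o (-1))) k
        rw [signAct_mulSingle, swap_apply_of_ne_of_ne hop.symm (Ne.symm hk), signAct_apply,
          swap_inv, swap_apply_right] at this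
        exact this.symm
    refine Subtype.ext (MonoidHom.eq_of_eqOn_dense closure_mulSingle ?_)
    rintro _ ⟨i, rfl⟩
    have hi : (Pi.mulSingle i (-1) : Fin m → ℤˣ) = signAct m (swap o i) (Pi.mulSingle o (-1)) := by
      rw [signAct_mulSingle, swap_apply_left]
    change (signEnd m x).1 (Pi.mulSingle i (-1)) = θ.1 (Pi.mulSingle i (-1))
    rw [hi, (signEnd m x).2, θ.2, ho]

lemma card_equivariantEnd_signAct (hm : 2 ≤ m) :
    Nat.card (EquivariantEnd (signAct m)) = 4 := by
  have hop : (⟨1, by omega⟩ : Fin m) ≠ ⟨0, by omega⟩ := by simp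
  rw [← Nat.card_congr (Equiv.ofBijective _ (signEnd_bijective hop))]
  simp

lemma signEnd_apply_of_ne {x : ℤˣ × ℤˣ} (hx : x.1 ≠ x.2) (v : Fin m → ℤˣ) :
    (signEnd m x).1 v = v * if x.2 = 1 then 1 else constSignProd m v := by
  simp only [signEnd, if_neg hx]
  split_ifs <;> simp

/-- Without the identity factor the map factors through `signProd`, so it kills vectors with two
negative entries. -/
lemma not_injective_signEnd_of_eq {o p : Fin m} (hop : p ≠ o) {x : ℤˣ × ℤˣ} (hx : x.1 = x.2) :
    ¬ Function.Injective (signEnd m x).1 := by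
  intro h
  have h1 : (signEnd m x).1 (Pi.mulSingle o (-1) * Pi.mulSingle p (-1)) = 1 := by
    have : constSignProd m (Pi.mulSingle o (-1) * Pi.mulSingle p (-1)) = 1 := by
      funext i
      rw [constSignProd_apply, map_mul, signProd_mulSingle, signProd_mulSingle]
      simp
    simp only [signEnd, if_pos hx]
    split_ifs
    · simp
    · rw [one_mul, this]
  have h2 := congrFun ((injective_iff_map_eq_one _).mp h _ h1) o
  rw [Pi.mul_apply, Pi.mulSingle_eq_same, Pi.mulSingle_eq_of_ne hop.symm] at h2
  simp at h2

lemma signProd_const (u : ℤˣ) : signProd m (fun _ => u) = u ^ m := by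
  simp [signProd]

/-- For even `m` a constant vector has product `1`, so `constSignProd` squares to the trivial map
and `v ↦ v * constSignProd m v` is an involution. -/
lemma bijective_signEnd_iff_of_even (hm : 2 ≤ m) (he : Even m) (x : ℤˣ × ℤˣ) :
    Function.Bijective (signEnd m x).1 ↔ x.1 ≠ x.2 := by
  have hop : (⟨1, by omega⟩ : Fin m) ≠ ⟨0, by omega⟩ := by simp
  refine ⟨fun h hx => not_injective_signEnd_of_eq hop hx h.1, fun hx => ?_⟩
  refine Function.Involutive.bijective fun v => ?_
  rw [signEnd_apply_of_ne hx, signEnd_apply_of_ne hx]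
  split_ifs
  · simp
  · have hc : constSignProd m (constSignProd m v) = 1 := by
      funext i
      have : signProd m (constSignProd m v) = (signProd m v) ^ m := signProd_const _
      rw [constSignProd_apply, this]
      rcases Int.units_eq_one_or (signProd m v) with h | h <;> rw [h]
      · simp
      · simpa using he.neg_one_pow
    rw [map_mul, hc, mul_one]
    funext i
    simp only [Pi.mul_apply, mul_assoc, Int.units_mul_self, mul_one]

/-- For odd `m` the vector with all entries `-1` is fixed by `constSignProd`, so `v ↦ v *
constSignProd m v` kills it. Only the identity is left. -/
lemma bijective_signEnd_iff_of_odd (hm : 2 ≤ m) (ho : Odd m) (x : ℤˣ × ℤˣ) :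
    Function.Bijective (signEnd m x).1 ↔ x = (-1, 1) := by
  have hop : (⟨1, by omega⟩ : Fin m) ≠ ⟨0, by omega⟩ := by simp
  constructor
  · intro h
    have hx : x.1 ≠ x.2 := fun hx => not_injective_signEnd_of_eq hop hx h.1
    have h2 : x.2 = 1 := by
      by_contra h2
      have hone : (signEnd m x).1 (fun _ => -1) = 1 := by
        rw [signEnd_apply_of_ne hx, if_neg h2]
        funext i
        rw [Pi.mul_apply, constSignProd_apply, signProd_const, ho.neg_one_pow]
        simp
      have := congrFun ((injective_iff_map_eq_one _).mp h.1 _ hone) ⟨0, by omega⟩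
      revert this
      simp
    refine Prod.ext ?_ h2
    rw [h2] at hx
    exact (Int.units_eq_one_or x.1).resolve_left hx
  · rintro rfl
    refine Function.Involutive.bijective fun v => ?_
    rw [signEnd_apply_of_ne (by decide), signEnd_apply_of_ne (by decide)]
    simp

lemma card_bijective_equivariantEnd_signAct {P : ℤˣ × ℤˣ → Prop} (hm : 2 ≤ m)
    (hP : ∀ x, Function.Bijective (signEnd m x).1 ↔ P x) :
    Nat.card {θ : EquivariantEnd (signAct m) // Function.Bijective θ.1} =
      Nat.card {x // P x} := by
  have hop : (⟨1, by omega⟩ : Fin m) ≠ ⟨0, by omega⟩ := by simp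
  exact (Nat.card_congr ((Equiv.ofBijective _ (signEnd_bijective hop)).subtypeEquiv
    (q := fun θ : EquivariantEnd (signAct m) => Function.Bijective θ.1)
    fun x => (hP x).symm)).symm

lemma card_bijective_equivariantEnd_signAct_of_even (hm : 2 ≤ m) (he : Even m) :
    Nat.card {θ : EquivariantEnd (signAct m) // Function.Bijective θ.1} = 2 := by
  rw [card_bijective_equivariantEnd_signAct hm (bijective_signEnd_iff_of_even hm he),
    Nat.card_eq_fintype_card]
  decide

lemma card_bijective_equivariantEnd_signAct_of_odd (hm : 2 ≤ m) (ho : Odd m) :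
    Nat.card {θ : EquivariantEnd (signAct m) // Function.Bijective θ.1} = 1 := by
  rw [card_bijective_equivariantEnd_signAct hm (bijective_signEnd_iff_of_odd hm ho)]
  simp

end Signs

section EvenSigns

lemma pairSign_apply_left {o p : Fin m} (h : p ≠ o) : (pairSign p o).1 o = -1 := by
  change (Pi.mulSingle p (-1) * Pi.mulSingle o (-1) : Fin m → ℤˣ) o = -1
  rw [Pi.mul_apply, Pi.mulSingle_eq_same, Pi.mulSingle_eq_of_ne h.symm, one_mul]

lemma pairSign_apply_of_ne {o p k : Fin m} (hp : k ≠ p) (ho : k ≠ o) :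
    (pairSign p o).1 k = 1 := by
  change (Pi.mulSingle p (-1) * Pi.mulSingle o (-1) : Fin m → ℤˣ) k = 1
  rw [Pi.mul_apply, Pi.mulSingle_eq_of_ne hp, Pi.mulSingle_eq_of_ne ho, one_mul]

lemma pairSign_ne_one {o p : Fin m} (h : p ≠ o) : pairSign p o ≠ 1 := by
  intro h1
  have := congrFun (congrArg Subtype.val h1) o
  rw [pairSign_apply_left h] at this
  revert this
  simp

/-- The even sign vectors are generated by any orbit of vectors with two negative entries. -/
lemma eq_of_map_pairSign_eq {H : Type*} [Group H] {f g : evenSigns m →* H} {o p : Fin m}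
    (hop : p ≠ o) (h : ∀ σ, f (evenSignAct m σ (pairSign p o)) = g (evenSignAct m σ (pairSign p o))) :
    f = g := by
  refine MonoidHom.eq_of_eqOn_dense (closure_pairSign o) ?_
  rintro _ ⟨i, hi, rfl⟩
  have := h (swap p i)
  rwa [evenSignAct_pairSign, swap_apply_left, swap_apply_of_ne_of_ne hop.symm hi.symm] at this

/-- By symmetry the image of `pairSign p o` has equal entries at `o` and `p`, and a common entry `b`
elsewhere. Comparing entries at a fourth point `r` in `pairSign p q * pairSign q o = pairSign p o`
gives `b * b = b`. -/
lemma equivariantEnd_evenSignAct_apply {o p q r : Fin m} (hpo : p ≠ o) (hqo : q ≠ o) (hqp : q ≠ p)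
    (hro : r ≠ o) (hrp : r ≠ p) (hrq : r ≠ q) (θ : EquivariantEnd (evenSignAct m)) (k : Fin m) :
    (θ.1 (pairSign p o)).1 k = if k = o ∨ k = p then (θ.1 (pairSign p o)).1 o else 1 := by
  have hθ : ∀ (σ : Perm (Fin m)) i, (θ.1 (pairSign (σ p) (σ o))).1 (σ i) = (θ.1 (pairSign p o)).1 i := by
    intro σ i
    rw [← evenSignAct_pairSign, θ.2, coe_evenSignAct, signAct_apply, Perm.inv_def, symm_apply_apply]
  split_ifs with h
  · rcases h with rfl | rfl
    · rfl
    · have := hθ (swap o k) o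
      rwa [swap_apply_left, swap_apply_right, pairSign_comm] at this
  · push Not at h
    have hr : (θ.1 (pairSign p o)).1 r = 1 := by
      have h1 := hθ (swap o q) r
      rw [swap_apply_of_ne_of_ne hpo hqp.symm, swap_apply_left,
        swap_apply_of_ne_of_ne hro hrq] at h1
      have h2 := hθ (swap p q) r
      rw [swap_apply_left, swap_apply_of_ne_of_ne hpo.symm hqo.symm,
        swap_apply_of_ne_of_ne hrp hrq] at h2
      have h3 : θ.1 (pairSign p q) * θ.1 (pairSign q o) = θ.1 (pairSign p o) := by
        rw [← map_mul, pairSign_mul_pairSign]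
      have h4 := congrFun (congrArg Subtype.val h3) r
      rw [Subgroup.coe_mul, Pi.mul_apply, h1, h2] at h4
      simpa using h4.symm
    have := hθ (swap r k) r
    rw [swap_apply_of_ne_of_ne hrp.symm h.2.symm, swap_apply_of_ne_of_ne hro.symm h.1.symm,
      swap_apply_left] at this
    rw [this, hr]

/-- One sign determines `θ`; its two values are realized by the trivial map and the identity. -/
lemma card_evenSignAct (hm : 4 ≤ m) :
    Nat.card (EquivariantEnd (evenSignAct m)) = 2 ∧
    Nat.card {θ : EquivariantEnd (evenSignAct m) // Function.Bijective θ.1} = 1 := by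
  let o : Fin m := ⟨0, by omega⟩
  let p : Fin m := ⟨1, by omega⟩
  let q : Fin m := ⟨2, by omega⟩
  let r : Fin m := ⟨3, by omega⟩
  have hpo : p ≠ o := by simp [p, o]
  let F : EquivariantEnd (evenSignAct m) → ℤˣ := fun θ => (θ.1 (pairSign p o)).1 o
  let tr : EquivariantEnd (evenSignAct m) := ⟨1, fun σ v => by simp⟩
  let id' : EquivariantEnd (evenSignAct m) := ⟨MonoidHom.id _, fun σ v => rfl⟩
  have htr : F tr = 1 := rfl
  have hid : F id' = -1 := pairSign_apply_left hpo
  have hF : Function.Bijective F := by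
    constructor
    · intro θ θ' h
      have h0 : θ.1 (pairSign p o) = θ'.1 (pairSign p o) := by
        ext1
        funext k
        have key := @equivariantEnd_evenSignAct_apply m o p q r hpo (by simp [q, o])
          (by simp [q, p]) (by simp [r, o]) (by simp [r, p]) (by simp [r, q])
        rw [key θ, key θ']
        change (if _ then F θ else 1) = if _ then F θ' else 1
        rw [h]
      exact Subtype.ext (eq_of_map_pairSign_eq hpo fun σ => by rw [θ.2, θ'.2, h0])
    · intro u
      rcases Int.units_eq_one_or u with rfl | rfl
      exacts [⟨tr, htr⟩, ⟨id', hid⟩]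
  refine ⟨?_, ?_⟩
  · rw [Nat.card_congr (Equiv.ofBijective F hF)]
    simp
  · rw [Nat.card_eq_one_iff_unique]
    refine ⟨⟨?_⟩, ⟨⟨id', Function.bijective_id⟩⟩⟩
    have key : ∀ θ : EquivariantEnd (evenSignAct m), Function.Bijective θ.1 → F θ = -1 := by
      intro θ hθ
      refine (Int.units_eq_one_or _).resolve_left fun h1 => ?_
      have : θ = tr := hF.1 (h1.trans htr.symm)
      subst this
      exact pairSign_ne_one hpo (hθ.1 (by rfl))
    rintro ⟨θ, hθ⟩ ⟨θ', hθ'⟩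
    exact Subtype.ext (hF.1 ((key θ hθ).trans (key θ' hθ').symm))

end EvenSigns

end ReflectionGroups

/-! ### Endomorphisms trivial on the alternating group, and the three proportions -/

namespace ReflectionGroups

open SemidirectProduct Equiv Equiv.Perm

variable {m : ℕ}

/-- A homomorphism that kills the alternating group takes the same value on all transpositions, and
these generate. -/
lemma eq_of_swap_eq {H : Type*} [Group H] {f g : Perm (Fin m) →* H}
    (hf : alternatingGroup (Fin m) ≤ f.ker) (hg : alternatingGroup (Fin m) ≤ g.ker)
    {s : Perm (Fin m)} (hs : s.IsSwap) (h : f s = g s) : f = g := by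
  refine MonoidHom.eq_of_eqOn_dense closure_isSwap fun t ht => ?_
  have hts : t * s⁻¹ ∈ alternatingGroup (Fin m) := by
    rw [mem_alternatingGroup, map_mul, map_inv, hs.sign_eq, ht.sign_eq]
    simp
  have key : ∀ f : Perm (Fin m) →* H, alternatingGroup (Fin m) ≤ f.ker → f t = f s := by
    intro f hf
    have : f (t * s⁻¹) = 1 := hf hts
    rwa [map_mul, map_inv, mul_inv_eq_one] at this
  rw [key f hf, key g hg, h]

/-- A group of order four, the second factor of which is generated by a transposition. -/
abbrev SwapGroup (p q : Fin m) : Type := ℤˣ × Subgroup.zpowers (swap p q)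

lemma card_swapGroup {p q : Fin m} (h : p ≠ q) : Nat.card (SwapGroup p q) = 4 := by
  have hs : (swap p q).IsSwap := ⟨p, q, h, rfl⟩
  rw [Nat.card_prod, Nat.card_zpowers, hs.orderOf]
  simp

section

variable {N : Type*} [CommGroup N] {act : Perm (Fin m) →* MulAut N}

/-- The second projection of `SwapGroup p q`, as a map into a semidirect product. -/
def swapGroupSnd (act : Perm (Fin m) →* MulAut N) (p q : Fin m) :
    SwapGroup p q →* N ⋊[act] Perm (Fin m) :=
  (inr.comp (Subgroup.zpowers (swap p q)).subtype).comp (MonoidHom.snd _ _)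

lemma comp_inr_eq_of_comp_eq {p q : Fin m} (hpq : p ≠ q) {j : SwapGroup p q →* N ⋊[act] Perm (Fin m)}
    (hj : j (1, ⟨swap p q, Subgroup.mem_zpowers _⟩) = inr (swap p q))
    {φ φ' : AlternatingTrivialEnd act} (h : φ.1.comp j = φ'.1.comp j) :
    φ.1.comp inr = φ'.1.comp inr := by
  refine eq_of_swap_eq φ.2 φ'.2 ⟨p, q, hpq, rfl⟩ ?_
  have := DFunLike.congr_fun h (1, ⟨swap p q, Subgroup.mem_zpowers _⟩)
  rwa [MonoidHom.comp_apply, MonoidHom.comp_apply, hj] at this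

/-- When `N` is killed, one transposition determines the endomorphism. The idle factor `ℤˣ` only
raises the order to four, so that the general bound applies. -/
lemma injective_comp_swapGroupSnd_of_map_inl {p q : Fin m} (hpq : p ≠ q)
    (h : ∀ (φ : AlternatingTrivialEnd act) v, φ.1 (inl v) = 1) :
    Function.Injective fun φ : AlternatingTrivialEnd act => φ.1.comp (swapGroupSnd act p q) := by
  intro φ φ' hφ
  refine Subtype.ext (hom_ext ?_ (comp_inr_eq_of_comp_eq hpq rfl hφ))
  ext1 v
  rw [MonoidHom.comp_apply, MonoidHom.comp_apply, h, h]

lemma map_inl_act (φ : N ⋊[act] Perm (Fin m) →* N ⋊[act] Perm (Fin m)) (σ : Perm (Fin m)) (v : N) :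
    φ (inl (act σ v)) = φ (inr σ) * φ (inl v) * (φ (inr σ))⁻¹ := by
  rw [inl_aut, map_mul, map_mul, map_inv, map_inv]

end

/-- Vectors that differ by an even permutation have the same image under `φ`. So `pairSign q p`,
`pairSign p o` and their product `pairSign q o` share one image `x`, and `x * x = x`. -/
lemma map_inl_evenSigns_eq_one (hm : 3 ≤ m) (φ : AlternatingTrivialEnd (evenSignAct m))
    (v : evenSigns m) : φ.1 (inl v) = 1 := by
  let o : Fin m := ⟨0, by omega⟩
  let p : Fin m := ⟨1, by omega⟩
  let q : Fin m := ⟨2, by omega⟩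
  have hpo : p ≠ o := by simp [p, o]
  have hqo : q ≠ o := by simp [q, o]
  have hqp : q ≠ p := by simp [p, q]
  have heven : ∀ σ ∈ alternatingGroup (Fin m), ∀ v,
      φ.1 (inl (evenSignAct m σ v)) = φ.1 (inl v) := by
    intro σ hσ v
    have : φ.1 (inr σ) = 1 := φ.2 hσ
    rw [map_inl_act, this]
    simp
  have hσ : ∀ {a b c d : Fin m}, a ≠ b → c ≠ d → swap a b * swap c d ∈ alternatingGroup (Fin m) :=
    fun h h' => mul_mem_alternatingGroup_of_isSwap ⟨_, _, h, rfl⟩ ⟨_, _, h', rfl⟩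
  have h1 : φ.1 (inl (pairSign q p)) = φ.1 (inl (pairSign p o)) := by
    have := heven _ (hσ hqo hpo) (pairSign p o)
    rwa [evenSignAct_pairSign, mul_apply, mul_apply, swap_apply_left, swap_apply_right,
      swap_apply_right, swap_apply_of_ne_of_ne hqp.symm hpo] at this
  have h2 : φ.1 (inl (pairSign q o)) = φ.1 (inl (pairSign p o)) := by
    have := heven _ (hσ hqp hpo) (pairSign p o)
    rwa [evenSignAct_pairSign, mul_apply, mul_apply, swap_apply_left, swap_apply_right,
      swap_apply_right, swap_apply_of_ne_of_ne hqo.symm hpo.symm, pairSign_comm] at this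
  have h3 : φ.1 (inl (pairSign p o)) = 1 := by
    have := congrArg (fun v => φ.1 (inl v)) (pairSign_mul_pairSign q p o)
    simp only [map_mul, h1, h2] at this
    simpa using this
  have : φ.1.comp inl = 1 := by
    refine eq_of_map_pairSign_eq hpo fun σ => ?_
    rw [MonoidHom.comp_apply, map_inl_act, h3]
    simp
  exact DFunLike.congr_fun this v

/-- The group generated by the sign change at `o` and the transposition of `p` and `q`. -/
def swapGroupHom {o p q : Fin m} (hpo : p ≠ o) (hqo : q ≠ o) :
    SwapGroup p q →* (Fin m → ℤˣ) ⋊[signAct m] Perm (Fin m) :=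
  MonoidHom.noncommCoprod (inl.comp (MonoidHom.mulSingle (fun _ : Fin m => ℤˣ) o))
    (inr.comp (Subgroup.zpowers (swap p q)).subtype) (by
      rintro u ⟨τ, k, rfl⟩
      have : Commute (inr (swap p q) : (Fin m → ℤˣ) ⋊[signAct m] Perm (Fin m))
          (inl (Pi.mulSingle o u)) := by
        rw [commute_iff_eq, ← mul_inv_eq_iff_eq_mul, ← map_inv, ← inl_aut, signAct_mulSingle,
          swap_apply_of_ne_of_ne hpo.symm hqo.symm]
      have := (this.zpow_left k).symm
      rw [← map_zpow] at this
      exact this)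

/-- The value at the transposition determines `φ` on `S_m`; the sign change at `o` then determines
the others, which are its conjugates under `S_m`. -/
lemma injective_comp_swapGroupHom {o p q : Fin m} (hpo : p ≠ o) (hqo : q ≠ o) (hpq : p ≠ q) :
    Function.Injective fun φ : AlternatingTrivialEnd (signAct m) =>
      φ.1.comp (swapGroupHom hpo hqo) := by
  intro φ φ' h
  have hr : φ.1.comp inr = φ'.1.comp inr :=
    comp_inr_eq_of_comp_eq hpq (by simp [swapGroupHom]) h
  refine Subtype.ext (hom_ext (MonoidHom.eq_of_eqOn_dense closure_mulSingle ?_) hr)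
  have ho : φ.1 (inl (Pi.mulSingle o (-1))) = φ'.1 (inl (Pi.mulSingle o (-1))) := by
    have := DFunLike.congr_fun h (-1, 1)
    simpa [swapGroupHom] using this
  rintro _ ⟨i, rfl⟩
  have hi : (Pi.mulSingle i (-1) : Fin m → ℤˣ) = signAct m (swap o i) (Pi.mulSingle o (-1)) := by
    rw [signAct_mulSingle, swap_apply_left]
  have hr' : φ.1 (inr (swap o i)) = φ'.1 (inr (swap o i)) := DFunLike.congr_fun hr _
  change φ.1 (inl (Pi.mulSingle i (-1))) = φ'.1 (inl (Pi.mulSingle i (-1)))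
  rw [hi, map_inl_act, map_inl_act, ho, hr']

/-- The proportion of automorphisms for the group of all signed permutations. -/
theorem abs_probAut_signs_sub_le (hm : 7 ≤ m) :
    |probAut ((Fin m → ℤˣ) ⋊[signAct m] Perm (Fin m)) - if Even m then 1 / 2 else 1 / 4|
      ≤ errorBound m := by
  have hpo : (⟨1, by omega⟩ : Fin m) ≠ ⟨0, by omega⟩ := by simp
  have hqo : (⟨2, by omega⟩ : Fin m) ≠ ⟨0, by omega⟩ := by simp
  have hpq : (⟨1, by omega⟩ : Fin m) ≠ ⟨2, by omega⟩ := by simp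
  have := abs_probAut_sub_le hm (act := signAct m) (by simp) (card_swapGroup hpq) _
    (injective_comp_swapGroupHom hpo hqo hpq)
  rw [card_equivariantEnd_signAct (by omega)] at this
  split_ifs with he
  · rw [card_bijective_equivariantEnd_signAct_of_even (by omega) he] at this
    convert this using 3
    norm_num
  · rw [card_bijective_equivariantEnd_signAct_of_odd (by omega) (Nat.not_even_iff_odd.mp he)]
      at this
    convert this using 3
    norm_num

/-- The proportion of automorphisms for the signed permutations with evenly many sign changes. -/
theorem abs_probAut_evenSigns_sub_le (hm : 7 ≤ m) :
    |probAut (evenSigns m ⋊[evenSignAct m] Perm (Fin m)) - 1 / 2| ≤ errorBound m := by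
  have hpq : (⟨1, by omega⟩ : Fin m) ≠ ⟨2, by omega⟩ := by simp
  have hN : Nat.card (evenSigns m) ≤ 2 ^ m := by
    refine (Nat.card_le_card_of_injective _ Subtype.val_injective).trans ?_
    simp
  have := abs_probAut_sub_le hm (act := evenSignAct m) hN (card_swapGroup hpq) _
    (injective_comp_swapGroupSnd_of_map_inl hpq (map_inl_evenSigns_eq_one (by omega)))
  rw [(card_evenSignAct (by omega)).1, (card_evenSignAct (by omega)).2] at this
  simpa using this

/-- The proportion of automorphisms for the symmetric group. -/
theorem abs_probAut_perm_sub_le (hm : 7 ≤ m) :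
    |probAut (Unit ⋊[(1 : Perm (Fin m) →* MulAut Unit)] Perm (Fin m)) - 1| ≤ errorBound m := by
  have hpq : (⟨1, by omega⟩ : Fin m) ≠ ⟨2, by omega⟩ := by simp
  have key := abs_probAut_sub_le hm (act := (1 : Perm (Fin m) →* MulAut Unit))
    (by simpa using Nat.one_le_two_pow) (card_swapGroup hpq) _
    (injective_comp_swapGroupSnd_of_map_inl hpq fun φ v => by
      rw [Subsingleton.elim v 1, map_one, map_one])
  have : Unique (EquivariantEnd (1 : Perm (Fin m) →* MulAut Unit)) :=
    { default := ⟨1, fun _ _ => rfl⟩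
      uniq := fun _ => Subtype.ext (MonoidHom.ext fun _ => rfl) }
  have h1 : Nat.card (EquivariantEnd (1 : Perm (Fin m) →* MulAut Unit)) = 1 := Nat.card_unique
  have h2 : Nat.card {θ : EquivariantEnd (1 : Perm (Fin m) →* MulAut Unit) //
      Function.Bijective θ.1} = 1 := by
    rw [Nat.card_eq_one_iff_unique]
    exact ⟨inferInstance, ⟨⟨1, fun _ _ => rfl⟩, fun _ _ _ => rfl, fun _ => ⟨1, rfl⟩⟩⟩
  simpa [h1, h2] using key

end ReflectionGroups

/-! ### The reflection groups as semidirect products -/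

namespace ReflectionGroups

open SemidirectProduct Equiv Equiv.Perm

variable {n : ℕ}

/-- The isometry that changes the signs of the coordinates. -/
noncomputable def signIsometry (v : Fin n → ℤˣ) :
    EuclideanSpace ℝ (Fin n) ≃ₗᵢ[ℝ] EuclideanSpace ℝ (Fin n) where
  toFun x := WithLp.toLp 2 fun i => ((v i : ℤ) : ℝ) * x i
  invFun x := WithLp.toLp 2 fun i => ((v i : ℤ) : ℝ) * x i
  map_add' x y := by ext i; simp [mul_add]
  map_smul' c x := by ext i; simp [mul_left_comm]
  left_inv x := by
    ext i
    rcases Int.units_eq_one_or (v i) with h | h <;> simp [h]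
  right_inv x := by
    ext i
    rcases Int.units_eq_one_or (v i) with h | h <;> simp [h]
  norm_map' x := by
    simp only [EuclideanSpace.norm_eq]
    congr 1
    refine Finset.sum_congr rfl fun i _ => ?_
    rcases Int.units_eq_one_or (v i) with h | h <;> simp [h]

/-- The isometry that permutes the coordinates. -/
noncomputable def permIsometry (σ : Perm (Fin n)) :
    EuclideanSpace ℝ (Fin n) ≃ₗᵢ[ℝ] EuclideanSpace ℝ (Fin n) :=
  LinearIsometryEquiv.piLpCongrLeft 2 ℝ ℝ σ

/-- The action of the signed permutations on Euclidean space. -/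
noncomputable def signedPermIsometry (n : ℕ) : (Fin n → ℤˣ) ⋊[signAct n] Perm (Fin n) →*
    (EuclideanSpace ℝ (Fin n) ≃ₗᵢ[ℝ] EuclideanSpace ℝ (Fin n)) where
  toFun g := signIsometry g.left * permIsometry g.right
  map_one' := by
    ext x i
    change ((1 : ℤ) : ℝ) * x i = x i
    simp
  map_mul' g h := by
    ext x i
    change (((g.left i * h.left (g.right⁻¹ i) : ℤˣ) : ℤ) : ℝ) * x ((g.right * h.right)⁻¹ i) =
      ((g.left i : ℤ) : ℝ) * (((h.left (g.right⁻¹ i) : ℤ) : ℝ) * x (h.right⁻¹ (g.right⁻¹ i)))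
    rw [mul_inv_rev, Perm.mul_apply]
    push_cast
    ring

lemma signedPermIsometry_apply (g : (Fin n → ℤˣ) ⋊[signAct n] Perm (Fin n))
    (x : EuclideanSpace ℝ (Fin n)) (i : Fin n) :
    signedPermIsometry n g x i = ((g.left i : ℤ) : ℝ) * x (g.right⁻¹ i) := rfl

lemma signedPermIsometry_inl (v : Fin n → ℤˣ) (x : EuclideanSpace ℝ (Fin n)) (i : Fin n) :
    signedPermIsometry n (inl v) x i = ((v i : ℤ) : ℝ) * x i := rfl

lemma signedPermIsometry_injective : Function.Injective (signedPermIsometry n) := by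
  rw [injective_iff_map_eq_one]
  intro g hg
  have key : ∀ i k, ((g.left i : ℤ) : ℝ) * (e k : EuclideanSpace ℝ (Fin n)) (g.right⁻¹ i) =
      (e k : EuclideanSpace ℝ (Fin n)) i := by
    intro i k
    rw [← signedPermIsometry_apply, hg]
    rfl
  have hr : g.right = 1 := by
    rw [← inv_eq_one]
    ext1 i
    by_contra h
    have := key i i
    rw [one_apply] at h
    rw [e, PiLp.single_apply, PiLp.single_apply, if_neg h] at this
    simp at this
  refine SemidirectProduct.ext ?_ hr
  funext i
  have := key i i
  rw [hr, inv_one, one_apply, e, PiLp.single_apply, if_pos rfl, mul_one] at this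
  rw [one_left, Pi.one_apply]
  exact Units.ext (Int.cast_eq_one.mp this)

lemma reflection_apply_of_inner {v : EuclideanSpace ℝ (Fin n)} (x : EuclideanSpace ℝ (Fin n))
    (i : Fin n) : (Submodule.span ℝ {v})ᗮ.reflection x i =
      x i - 2 * (inner ℝ v x / ‖v‖ ^ 2) * v i := by
  rw [Submodule.reflection_orthogonal_apply, Submodule.reflection_singleton_apply]
  simp
  ring

lemma inner_e_left (i : Fin n) (x : EuclideanSpace ℝ (Fin n)) : inner ℝ (e i) x = x i := by
  simp [e, EuclideanSpace.inner_single_left]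

lemma norm_sq_e_sub {i j : Fin n} (h : i ≠ j) : ‖(e i - e j : EuclideanSpace ℝ (Fin n))‖ ^ 2 = 2 := by
  rw [← real_inner_self_eq_norm_sq, inner_sub_left, inner_e_left, inner_e_left]
  simp [e, h, h.symm]
  norm_num

lemma norm_sq_e_add {i j : Fin n} (h : i ≠ j) : ‖(e i + e j : EuclideanSpace ℝ (Fin n))‖ ^ 2 = 2 := by
  rw [← real_inner_self_eq_norm_sq, inner_add_left, inner_e_left, inner_e_left]
  simp [e, h, h.symm]
  norm_num

lemma reflection_e_sub {i j : Fin n} (h : i ≠ j) :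
    (Submodule.span ℝ {(e i - e j : EuclideanSpace ℝ (Fin n))})ᗮ.reflection =
      signedPermIsometry n (inr (swap i j)) := by
  ext x k
  rw [reflection_apply_of_inner, norm_sq_e_sub h, inner_sub_left, inner_e_left, inner_e_left,
    signedPermIsometry_apply]
  by_cases hi : k = i
  · subst hi; simp [e, h]; ring
  by_cases hj : k = j
  · subst hj; simp [e, hi]; ring
  simp [e, hi, hj, swap_apply_of_ne_of_ne]

lemma reflection_e_add {i j : Fin n} (h : i ≠ j) :
    (Submodule.span ℝ {(e i + e j : EuclideanSpace ℝ (Fin n))})ᗮ.reflection =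
      signedPermIsometry n (inl (pairSign i j).1 * inr (swap i j)) := by
  ext x k
  rw [reflection_apply_of_inner, norm_sq_e_add h, inner_add_left, inner_e_left, inner_e_left,
    signedPermIsometry_apply]
  by_cases hi : k = i
  · subst hi
    have : (pairSign k j).1 k = -1 := by rw [pairSign_comm, pairSign_apply_left h.symm]
    simp [e, h, this]
    ring
  by_cases hj : k = j
  · subst hj
    have : (pairSign i k).1 k = -1 := pairSign_apply_left h
    simp [e, hi, this]
    ring
  have : (pairSign i j).1 k = 1 := pairSign_apply_of_ne hi hj
  simp [e, hi, hj, swap_apply_of_ne_of_ne, this]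

lemma reflection_e (i : Fin n) :
    (Submodule.span ℝ {(e i : EuclideanSpace ℝ (Fin n))})ᗮ.reflection =
      signedPermIsometry n (inl (Pi.mulSingle i (-1))) := by
  ext x k
  rw [reflection_apply_of_inner, inner_e_left, signedPermIsometry_inl]
  by_cases hi : k = i
  · subst hi; simp [e]; ring
  · simp [e, hi]

section Equiv

variable {N : Type*} [CommGroup N] {act : Perm (Fin n) →* MulAut N}

/-- The action on Euclidean space of a semidirect product that acts by signed permutations. -/
noncomputable def equivariantIsometry (ι : N →* (Fin n → ℤˣ))
    (hact : ∀ σ v, ι (act σ v) = signAct n σ (ι v)) :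
    N ⋊[act] Perm (Fin n) →* (EuclideanSpace ℝ (Fin n) ≃ₗᵢ[ℝ] EuclideanSpace ℝ (Fin n)) :=
  (signedPermIsometry n).comp (SemidirectProduct.map ι (MonoidHom.id _)
    fun σ => MonoidHom.ext fun v => hact σ v)

variable {ι : N →* (Fin n → ℤˣ)} {hact : ∀ σ v, ι (act σ v) = signAct n σ (ι v)}

lemma equivariantIsometry_inl (v : N) :
    equivariantIsometry ι hact (inl v) = signedPermIsometry n (inl (ι v)) := by
  rw [equivariantIsometry, MonoidHom.comp_apply, map_inl]

lemma equivariantIsometry_inr (σ : Perm (Fin n)) :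
    equivariantIsometry ι hact (inr σ) = signedPermIsometry n (inr σ) := by
  rw [equivariantIsometry, MonoidHom.comp_apply, map_inr, MonoidHom.id_apply]

lemma equivariantIsometry_injective (hι : Function.Injective ι) :
    Function.Injective (equivariantIsometry ι hact) := by
  refine signedPermIsometry_injective.comp ?_
  intro g h hgh
  rw [SemidirectProduct.ext_iff, map_left, map_left, map_right, map_right] at hgh
  exact SemidirectProduct.ext (hι hgh.1) hgh.2

variable {Φ : Set (EuclideanSpace ℝ (Fin n))}

lemma reflection_mem {v : EuclideanSpace ℝ (Fin n)} (hv : v ∈ Φ) :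
    (Submodule.span ℝ {v})ᗮ.reflection ∈ reflectionGroup Φ :=
  Subgroup.subset_closure ⟨v, hv, rfl⟩

lemma signedPermIsometry_inr_mem (hΦ : ∀ i j, i ≠ j → e i - e j ∈ Φ) (σ : Perm (Fin n)) :
    signedPermIsometry n (inr σ) ∈ reflectionGroup Φ := by
  have : (⊤ : Subgroup (Perm (Fin n))) ≤
      (reflectionGroup Φ).comap ((signedPermIsometry n).comp inr) := by
    rw [← closure_isSwap, Subgroup.closure_le]
    rintro _ ⟨i, j, hij, rfl⟩
    change signedPermIsometry n (inr (swap i j)) ∈ reflectionGroup Φ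
    rw [← reflection_e_sub hij]
    exact reflection_mem (hΦ i j hij)
  exact this (Subgroup.mem_top σ)

/-- A reflection group is isomorphic to a semidirect product that acts by signed permutations, if
the reflections are in the image and the kernel acts by elements of the reflection group. -/
lemma nonempty_mulEquiv (hι : Function.Injective ι)
    (hact : ∀ σ v, ι (act σ v) = signAct n σ (ι v)) (hΦ : ∀ i j, i ≠ j → e i - e j ∈ Φ)
    (hrange : ∀ v ∈ Φ,
      (Submodule.span ℝ {v})ᗮ.reflection ∈ (equivariantIsometry ι hact).range)
    (hl : ∀ v, signedPermIsometry n (inl (ι v)) ∈ reflectionGroup Φ) :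
    Nonempty (reflectionGroup Φ ≃* N ⋊[act] Perm (Fin n)) := by
  have : reflectionGroup Φ = (equivariantIsometry ι hact).range := by
    refine le_antisymm ?_ ?_
    · rw [reflectionGroup, Subgroup.closure_le]
      rintro _ ⟨v, hv, rfl⟩
      exact hrange v hv
    · rintro _ ⟨g, rfl⟩
      rw [← inl_left_mul_inr_right g, map_mul, equivariantIsometry_inl, equivariantIsometry_inr]
      exact mul_mem (hl _) (signedPermIsometry_inr_mem hΦ _)
  exact ⟨(MulEquiv.subgroupCongr this).trans
    (MonoidHom.ofInjective (equivariantIsometry_injective hι)).symm⟩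

lemma reflection_e_sub_mem_range {i j : Fin n} (h : i ≠ j) :
    (Submodule.span ℝ {(e i - e j : EuclideanSpace ℝ (Fin n))})ᗮ.reflection ∈
      (equivariantIsometry ι hact).range :=
  ⟨inr (swap i j), by rw [equivariantIsometry_inr, reflection_e_sub h]⟩

lemma reflection_e_add_mem_range {i j : Fin n} (h : i ≠ j) (w : N) (hw : ι w = (pairSign i j).1) :
    (Submodule.span ℝ {(e i + e j : EuclideanSpace ℝ (Fin n))})ᗮ.reflection ∈
      (equivariantIsometry ι hact).range :=
  ⟨inl w * inr (swap i j), by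
    rw [map_mul, equivariantIsometry_inr, equivariantIsometry_inl, reflection_e_add h, hw, map_mul]⟩

end Equiv

lemma nonempty_mulEquiv_A (n : ℕ) :
    Nonempty (A n ≃* Unit ⋊[(1 : Perm (Fin (n + 1)) →* MulAut Unit)] Perm (Fin (n + 1))) := by
  refine nonempty_mulEquiv (ι := 1) (Function.injective_of_subsingleton _) (by simp)
    (fun i j hij => ⟨i, j, hij, rfl⟩) ?_ ?_
  · rintro _ ⟨i, j, hij, rfl⟩
    exact reflection_e_sub_mem_range hij
  · intro v
    simp [one_mem]

lemma nonempty_mulEquiv_D (n : ℕ) :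
    Nonempty (D n ≃* evenSigns n ⋊[evenSignAct n] Perm (Fin n)) := by
  refine nonempty_mulEquiv (ι := (evenSigns n).subtype) Subtype.val_injective (fun _ _ => rfl)
    (fun i j hij => ⟨i, j, hij, Or.inl rfl⟩) ?_ ?_
  · rintro _ ⟨i, j, hij, rfl | rfl⟩
    · exact reflection_e_sub_mem_range hij
    · exact reflection_e_add_mem_range hij (pairSign i j) rfl
  · intro v
    -- The generators `pairSign i o` need a base point `o`, which is missing for `n = 0`.
    rcases Nat.eq_zero_or_pos n with rfl | hn
    · rw [Subsingleton.elim ((evenSigns 0).subtype v) 1, map_one, map_one]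
      exact one_mem _
    have : (⊤ : Subgroup (evenSigns n)) ≤ (reflectionGroup (rootsD n)).comap
        ((signedPermIsometry n).comp (inl.comp (evenSigns n).subtype)) := by
      rw [← closure_pairSign ⟨0, hn⟩, Subgroup.closure_le]
      rintro _ ⟨i, hi, rfl⟩
      change signedPermIsometry n (inl (pairSign i ⟨0, hn⟩).1) ∈ reflectionGroup (rootsD n)
      -- The reflections with roots `e i + e o` and `e i - e o` differ by the sign change at both
      -- `i` and `o`.
      have h1 := reflection_mem (Φ := rootsD n) ⟨i, _, hi, Or.inr rfl⟩
      have h2 := reflection_mem (Φ := rootsD n) ⟨i, _, hi, Or.inl rfl⟩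
      rw [reflection_e_add hi, map_mul] at h1
      rw [reflection_e_sub hi] at h2
      exact (Subgroup.mul_mem_cancel_right _ h2).mp h1
    exact this (Subgroup.mem_top v)

lemma nonempty_mulEquiv_C (n : ℕ) :
    Nonempty (C n ≃* (Fin n → ℤˣ) ⋊[signAct n] Perm (Fin n)) := by
  refine nonempty_mulEquiv (ι := MonoidHom.id _) Function.injective_id (fun _ _ => rfl)
    (fun i j hij => Or.inl ⟨i, j, hij, Or.inl rfl⟩) ?_ ?_
  · rintro _ (⟨i, j, hij, rfl | rfl⟩ | ⟨i, rfl⟩)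
    · exact reflection_e_sub_mem_range hij
    · exact reflection_e_add_mem_range hij (pairSign i j).1 rfl
    · exact ⟨inl (Pi.mulSingle i (-1)), by
        rw [equivariantIsometry_inl, reflection_e, MonoidHom.id_apply]⟩
  · intro v
    have : (⊤ : Subgroup (Fin n → ℤˣ)) ≤ (reflectionGroup (rootsC n)).comap
        ((signedPermIsometry n).comp inl) := by
      rw [← closure_mulSingle, Subgroup.closure_le]
      rintro _ ⟨i, rfl⟩
      change signedPermIsometry n (inl (Pi.mulSingle i (-1))) ∈ reflectionGroup (rootsC n)
      rw [← reflection_e]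
      exact reflection_mem (Or.inr ⟨i, rfl⟩)
    exact this (Subgroup.mem_top v)

lemma tendsto_of_abs_sub_le {f : ℕ → ℝ} {k : ℕ → ℕ} {c : ℝ} (hk : Tendsto k atTop atTop)
    (h : ∀ n, 7 ≤ k n → |f n - c| ≤ errorBound (k n)) : Tendsto f atTop (𝓝 c) := by
  rw [tendsto_iff_norm_sub_tendsto_zero]
  refine squeeze_zero' (Eventually.of_forall fun _ => norm_nonneg _) ?_
    (tendsto_errorBound.comp hk)
  filter_upwards [hk.eventually_ge_atTop 7] with n hn using h n hn

end ReflectionGroups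

theorem theorem4 :
    Tendsto (fun n : ℕ => ReflectionGroups.probAut (ReflectionGroups.C (2 * n)))
      atTop (𝓝 (1 / 2)) ∧
    Tendsto (fun n : ℕ => ReflectionGroups.probAut (ReflectionGroups.D n))
      atTop (𝓝 (1 / 2)) ∧
    Tendsto (fun n : ℕ => ReflectionGroups.probAut (ReflectionGroups.C (2 * n + 1)))
      atTop (𝓝 (1 / 4)) ∧
    Tendsto (fun n : ℕ => ReflectionGroups.probAut (ReflectionGroups.A n))
      atTop (𝓝 1) := by
  have h2 : Tendsto (fun n : ℕ => 2 * n) atTop atTop :=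
    tendsto_id.const_mul_atTop' (by norm_num)
  refine ⟨ReflectionGroups.tendsto_of_abs_sub_le h2 fun n hn => ?_,
    ReflectionGroups.tendsto_of_abs_sub_le tendsto_id fun n hn => ?_,
    ReflectionGroups.tendsto_of_abs_sub_le ((tendsto_add_atTop_nat 1).comp h2) fun n hn => ?_,
    ReflectionGroups.tendsto_of_abs_sub_le (tendsto_add_atTop_nat 1) fun n hn => ?_⟩
  · obtain ⟨f⟩ := ReflectionGroups.nonempty_mulEquiv_C (2 * n)
    have := ReflectionGroups.abs_probAut_signs_sub_le hn
    rwa [if_pos (by simp), ← ReflectionGroups.probAut_congr f] at this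
  · obtain ⟨f⟩ := ReflectionGroups.nonempty_mulEquiv_D n
    have := ReflectionGroups.abs_probAut_evenSigns_sub_le (m := n) hn
    rwa [← ReflectionGroups.probAut_congr f] at this
  · obtain ⟨f⟩ := ReflectionGroups.nonempty_mulEquiv_C (2 * n + 1)
    have := ReflectionGroups.abs_probAut_signs_sub_le (m := 2 * n + 1) hn
    rwa [if_neg (by simp), ← ReflectionGroups.probAut_congr f] at this
  · obtain ⟨f⟩ := ReflectionGroups.nonempty_mulEquiv_A n
    have := ReflectionGroups.abs_probAut_perm_sub_le hn
    rwa [← ReflectionGroups.probAut_congr f] at this
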